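/- Let $d\ge 1$, let $U\subset\mathbb R^d$ be a non-empty open set and let $\omega_0,\omega_1:U\to(0,\infty)$ be Lebesgue measurable functions ("weights"). A weight $\omega$ satisfies the *compact boundedness condition* if $0<\inf_K\omega\le\sup_K\omega<\infty$ for every compact $K\subset U$. For $\theta\in(0,1)$ put $\omega_\theta=\omega_0^{1-\theta}\omega_1^{\theta}$, and put $r_\omega=\omega_0/\omega_1$. For $p\in[1,\infty)$, $W^{1,p}(U,\omega)$ is the space of (classes of a.e. equal) functions $\phi:U\to\mathbb C$ that have a weak gradient on $U$ and for which $$\|\phi\|_{W^{1,p}(U,\omega)}=\Big(\int_U|\phi|^p\,\omega\,dx+\sum_{i=1}^d\int_U|\partial_i\phi|^p\,\omega\,dx\Big)^{1/p}<\infty .$$ $Lip_c(U)$ is the space of Lipschitz functions $U\to\mathbb C$ with compact support in $U$, and $W^{1,p}_0(U,\omega)$ is the closure of $Lip_c(U)$ in $W^{1,p}(U,\omega)$, with the same norm. $\mathcal W^p(U,\theta,r_\omega)$ is the space of all $\phi\in W^{1,p}(U,\omega_\theta)$ with $\phi\,|\nabla\log r_\omega|\in L^p(U,\omega_\theta)$,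 normed by $$\Big(\|\phi\|^p_{W^{1,p}(U,\omega_\theta)}+\int_U|\phi|^p\,|\nabla\log r_\omega|^p\,\omega_\theta\,dx\Big)^{1/p},$$ and $\mathcal W^p_0(U,\theta,r_\omega)$ is the closure of $Lip_c(U)$ in it. A function on $U$ is *locally Lipschitz* if it is Lipschitz on every compact subset of $U$. $[A_0,A_1]_\theta$ denotes Calderón's complex interpolation space: the set of all $f(\theta)$ where $f:\{0\le\operatorname{Re}z\le1\}\to A_0+A_1$ is continuous and bounded, is analytic in the interior of the strip, and is such that $t\mapsto f(j+it)$ is a bounded continuous map from $\mathbb R$ into $A_j$ for $j=0,1$; the norm of $a$ is the infimum of $\max\{\sup_t\|f(it)\|_{A_0},\sup_t\|f(1+it)\|_{A_1}\}$ over all such $f$ with $f(\theta)=a$. **Theorem 1.4.** Let $g:U\to\mathbb R$ be Lipschitz, let $\omega_0(x)=\omega_1(x)e^{g(x)}$ for all $x\in U$, and let at least one of $\omega_0,\omega_1$ satisfy the compact boundedness condition. Then: 1. Both $\omega_0$ and $\omega_1$ satisfy the compact boundedness condition, and $r_\omega$ is locally Lipschitz on $U$. 2. If $U=\mathbb R^d$,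 then, to within equivalence of norms, $$[W^{1,p}(\mathbb R^d,\omega_0),W^{1,p}(\mathbb R^d,\omega_1)]_\theta=W^{1,p}(\mathbb R^d,\omega_\theta)\quad\text{for all }p\in[1,\infty)\text{ and }\theta\in(0,1).$$ 3. Suppose that for some $q\in[1,\infty)$ every $\phi\in W^{1,q}_0(U,\omega_0)\cap W^{1,q}_0(U,\omega_1)$ admits a sequence in $Lip_c(U)$ that converges to $\phi$ in one of the spaces $W^{1,q}(U,\omega_0)$, $W^{1,q}(U,\omega_1)$ and is bounded in the other. Then, to within equivalence of norms, $$[W^{1,p}_0(U,\omega_0),W^{1,p}_0(U,\omega_1)]_\theta=W^{1,p}_0(U,\omega_\theta)\quad\text{for all }p\in[1,\infty)\text{ and }\theta\in(0,1).$$ 4. Let $p\in[1,\infty)$ be such that $W^{1,p}_0(U,\omega_j)=W^{1,p}(U,\omega_j)$ for $j=0,1$ and $\mathcal W^p_0(U,\theta,r_\omega)=\mathcal W^p(U,\theta,r_\omega)$ for all $\theta\in(0,1)$. Then, to within equivalence of norms, $$[W^{1,p}(U,\omega_0),W^{1,p}(U,\omega_1)]_\theta=W^{1,p}(U,\omega_\theta)\quad\text{for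 that }p\text{ and all }\theta\in(0,1).$$ -/

import Mathlib

open Set Filter Topology MeasureTheory
open scoped NNReal ENNReal

noncomputable section

/-! ### Calderon's complex interpolation method

`A₀` and `A₁` are complex normed spaces, placed inside a common vector space `V` by linear maps
`ι₀`, `ι₁` (injective in all uses). -/

namespace ComplexInterp

variable {V A₀ A₁ : Type*} [AddCommGroup V] [Module ℂ V]
  [NormedAddCommGroup A₀] [NormedSpace ℂ A₀] [NormedAddCommGroup A₁] [NormedSpace ℂ A₁]

/-- The map `(a₀, a₁) ↦ a₀ + a₁` from the `ℓ¹`-direct sum to the ambient space. -/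
def sumMap (ι₀ : A₀ →ₗ[ℂ] V) (ι₁ : A₁ →ₗ[ℂ] V) : WithLp 1 (A₀ × A₁) →ₗ[ℂ] V :=
  (ι₀.coprod ι₁) ∘ₗ (WithLp.linearEquiv 1 ℂ (A₀ × A₁)).toLinearMap

/-- The space `A₀ + A₁`. As a vector space it is the range of `sumMap`; presenting it as a quotient
of the `ℓ¹`-direct sum gives it the quotient norm, which is
`‖a‖ = inf { ‖a₀‖ + ‖a₁‖ : a₀ + a₁ = a }`. -/
abbrev SumSpace (ι₀ : A₀ →ₗ[ℂ] V) (ι₁ : A₁ →ₗ[ℂ] V) : Type _ :=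
  WithLp 1 (A₀ × A₁) ⧸ LinearMap.ker (sumMap ι₀ ι₁)

variable (ι₀ : A₀ →ₗ[ℂ] V) (ι₁ : A₁ →ₗ[ℂ] V)

/-- The (injective) inclusion of `A₀ + A₁` in the ambient space. -/
def SumSpace.toAmbient : SumSpace ι₀ ι₁ →ₗ[ℂ] V :=
  (LinearMap.ker (sumMap ι₀ ι₁)).liftQ (sumMap ι₀ ι₁) le_rfl

/-- The inclusion of `A₀` in `A₀ + A₁`. -/
def SumSpace.inl (a : A₀) : SumSpace ι₀ ι₁ :=
  Submodule.Quotient.mk (WithLp.toLp 1 (a, 0))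

/-- The inclusion of `A₁` in `A₀ + A₁`. -/
def SumSpace.inr (a : A₁) : SumSpace ι₀ ι₁ :=
  Submodule.Quotient.mk (WithLp.toLp 1 (0, a))

/-- The closed strip `0 ≤ Re z ≤ 1`. -/
def strip : Set ℂ := {z | 0 ≤ z.re ∧ z.re ≤ 1}

/-- The elements of `𝓕(A₀, A₁)`: functions from the closed strip to `A₀ + A₁` (the values outside
the strip are irrelevant) that are continuous and bounded on the strip, analytic in its interior,
and for which `t ↦ f (j + i t)` is a bounded continuous map into `A_j`. -/
structure CalderonFunction where
  toFun : ℂ → SumSpace ι₀ ι₁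
  continuousOn : ContinuousOn toFun strip
  bounded : ∃ C : ℝ, ∀ z ∈ strip, ‖toFun z‖ ≤ C
  differentiableOn : DifferentiableOn ℂ toFun (interior strip)
  bdry₀ : BoundedContinuousFunction ℝ A₀
  bdry₁ : BoundedContinuousFunction ℝ A₁
  toFun_bdry₀ : ∀ t : ℝ, toFun (t * Complex.I) = SumSpace.inl ι₀ ι₁ (bdry₀ t)
  toFun_bdry₁ : ∀ t : ℝ, toFun (1 + t * Complex.I) = SumSpace.inr ι₀ ι₁ (bdry₁ t)

variable {ι₀ ι₁} in
/-- `‖f‖ = max (sup_t ‖f (i t)‖_{A₀}) (sup_t ‖f (1 + i t)‖_{A₁})`. -/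
def CalderonFunction.norm (f : CalderonFunction ι₀ ι₁) : ℝ := max ‖f.bdry₀‖ ‖f.bdry₁‖

/-- The complex interpolation space `[A₀, A₁]_θ`, as a subset of the ambient space. -/
def space (θ : ℝ) : Set V :=
  {v | ∃ f : CalderonFunction ι₀ ι₁, SumSpace.toAmbient ι₀ ι₁ (f.toFun θ) = v}

/-- The norm of `[A₀, A₁]_θ` (meaningful for elements of `space ι₀ ι₁ θ`). -/
def spaceNorm (θ : ℝ) (v : V) : ℝ :=
  sInf {r | ∃ f : CalderonFunction ι₀ ι₁,
    SumSpace.toAmbient ι₀ ι₁ (f.toFun θ) = v ∧ f.norm = r}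

/-- `[A₀, A₁]_θ = A` to within equivalence of norms, where `A` is a normed space placed in the
ambient space by `ι`. -/
def EqUpToEquivNorms (θ : ℝ) {A : Type*} [NormedAddCommGroup A] [NormedSpace ℂ A]
    (ι : A →ₗ[ℂ] V) : Prop :=
  space ι₀ ι₁ θ = Set.range ι ∧
    ∃ c C : ℝ, 0 < c ∧ 0 < C ∧
      ∀ a : A, c * ‖a‖ ≤ spaceNorm ι₀ ι₁ θ (ι a) ∧ spaceNorm ι₀ ι₁ θ (ι a) ≤ C * ‖a‖

end ComplexInterp

/-! ### Weights and weighted Sobolev spaces -/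

namespace WSob

/-- `ℝ^d` with its Euclidean norm. -/
abbrev E (d : ℕ) : Type := EuclideanSpace ℝ (Fin d)

variable {d : ℕ} {U : TopologicalSpace.Opens (E d)}

/-- A weight function on `U`: a Lebesgue measurable function, strictly positive on `U` (its values
outside `U` are irrelevant). -/
structure Weight (U : TopologicalSpace.Opens (E d)) where
  toFun : E d → ℝ
  aemeasurable : AEMeasurable toFun (volume.restrict (U : Set (E d)))
  pos : ∀ x ∈ U, 0 < toFun x

namespace Weight

/-- The measure `ω(x) dx` on `U`. -/
def measure (ω : Weight U) : Measure (E d) :=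
  (volume.restrict (U : Set (E d))).withDensity fun x => ENNReal.ofReal (ω.toFun x)

lemma measure_ac (ω : Weight U) : ω.measure ≪ volume.restrict (U : Set (E d)) :=
  withDensity_absolutelyContinuous _ _

lemma ac_measure (ω : Weight U) : volume.restrict (U : Set (E d)) ≪ ω.measure := by
  refine withDensity_absolutelyContinuous' ω.aemeasurable.ennreal_ofReal ?_
  filter_upwards [ae_restrict_mem U.isOpen.measurableSet] with x hx
  simpa using ω.pos x hx

/-- The compact boundedness condition: `0 < inf_K ω ≤ sup_K ω < ∞` for every compact `K ⊆ U`. -/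
def CompactlyBounded (ω : Weight U) : Prop :=
  ∀ K : Set (E d), IsCompact K → K ⊆ U →
    ∃ m M : ℝ, 0 < m ∧ ∀ x ∈ K, m ≤ ω.toFun x ∧ ω.toFun x ≤ M

/-- The weight `ω_θ = ω₀^(1-θ) ω₁^θ`. -/
def interp (ω₀ ω₁ : Weight U) (θ : ℝ) : Weight U where
  toFun x := ω₀.toFun x ^ (1 - θ) * ω₁.toFun x ^ θ
  aemeasurable := (ω₀.aemeasurable.pow_const _).mul (ω₁.aemeasurable.pow_const _)
  pos x hx := mul_pos (Real.rpow_pos_of_pos (ω₀.pos x hx) _) (Real.rpow_pos_of_pos (ω₁.pos x hx) _)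

/-- The quotient `r_ω = ω₀ / ω₁`. -/
def ratio (ω₀ ω₁ : Weight U) (x : E d) : ℝ := ω₀.toFun x / ω₁.toFun x

end Weight

/-- A function is locally Lipschitz on `U` if it is Lipschitz on every compact subset of `U`. -/
def LocLipschitzOn (U : TopologicalSpace.Opens (E d)) (r : E d → ℝ) : Prop :=
  ∀ K : Set (E d), IsCompact K → K ⊆ U → ∃ C : ℝ≥0, LipschitzOnWith C r K

/-- `G` is the weak `i`-th partial derivative of `φ` on `U`; both functions are locally integrable
on `U` with respect to Lebesgue measure. -/
structure HasWeakPartial (U : TopologicalSpace.Opens (E d)) (i : Fin d) (φ G : E d → ℂ) :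
    Prop where
  locInt : ∀ K : Set (E d), IsCompact K → K ⊆ U → IntegrableOn φ K volume
  locInt_deriv : ∀ K : Set (E d), IsCompact K → K ⊆ U → IntegrableOn G K volume
  integral_eq : ∀ ψ : E d → ℝ, ContDiff ℝ ((⊤ : ℕ∞) : WithTop ℕ∞) ψ → HasCompactSupport ψ → tsupport ψ ⊆ U →
    ∫ x in (U : Set (E d)), fderiv ℝ ψ x (EuclideanSpace.single i 1) • φ x =
      - ∫ x in (U : Set (E d)), ψ x • G x

lemma integrable_smul_of_locInt {φ : E d → ℂ}
    (hφ : ∀ K : Set (E d), IsCompact K → K ⊆ U → IntegrableOn φ K volume)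
    {χ : E d → ℝ} (hχ : Continuous χ) {K : Set (E d)} (hK : IsCompact K) (hKU : K ⊆ U)
    (hs : Function.support χ ⊆ K) :
    Integrable (fun x => χ x • φ x) (volume.restrict (U : Set (E d))) := by
  have h1 : IntegrableOn (fun x => χ x • φ x) K volume :=
    (hφ K hK hKU).continuousOn_smul hχ.continuousOn hK
  have h2 : Function.support (fun x => χ x • φ x) ⊆ K := by
    intro x hx
    apply hs
    intro h0
    apply hx
    simp [h0]
  exact ((integrableOn_iff_integrable_of_support_subset h2).1 h1).integrableOn

namespace HasWeakPartial

variable {i : Fin d} {φ φ' G G' : E d → ℂ}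

lemma congr (h : HasWeakPartial U i φ G) (hφ : φ =ᵐ[volume.restrict (U : Set (E d))] φ')
    (hG : G =ᵐ[volume.restrict (U : Set (E d))] G') : HasWeakPartial U i φ' G' where
  locInt K hK hKU := (h.locInt K hK hKU).congr (ae_restrict_of_ae_restrict_of_subset hKU hφ)
  locInt_deriv K hK hKU :=
    (h.locInt_deriv K hK hKU).congr (ae_restrict_of_ae_restrict_of_subset hKU hG)
  integral_eq ψ h1 h2 h3 := by
    have e1 : ∫ x in (U : Set (E d)), fderiv ℝ ψ x (EuclideanSpace.single i 1) • φ' x =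
        ∫ x in (U : Set (E d)), fderiv ℝ ψ x (EuclideanSpace.single i 1) • φ x := by
      apply integral_congr_ae
      filter_upwards [hφ] with x hx
      rw [hx]
    have e2 : ∫ x in (U : Set (E d)), ψ x • G' x = ∫ x in (U : Set (E d)), ψ x • G x := by
      apply integral_congr_ae
      filter_upwards [hG] with x hx
      rw [hx]
    rw [e1, e2]
    exact h.integral_eq ψ h1 h2 h3

lemma zero : HasWeakPartial U i (0 : E d → ℂ) 0 where
  locInt _ _ _ := integrableOn_zero
  locInt_deriv _ _ _ := integrableOn_zero
  integral_eq ψ _ _ _ := by simp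

lemma add (h : HasWeakPartial U i φ G) (h' : HasWeakPartial U i φ' G') :
    HasWeakPartial U i (φ + φ') (G + G') where
  locInt K hK hKU := (h.locInt K hK hKU).add (h'.locInt K hK hKU)
  locInt_deriv K hK hKU := (h.locInt_deriv K hK hKU).add (h'.locInt_deriv K hK hKU)
  integral_eq ψ h1 h2 h3 := by
    have hc : Continuous fun x => fderiv ℝ ψ x (EuclideanSpace.single i 1) :=
      (h1.continuous_fderiv (by simp)).clm_apply continuous_const
    have hs : (Function.support fun x => fderiv ℝ ψ x (EuclideanSpace.single i 1)) ⊆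
        tsupport ψ := by
      intro x hx
      apply support_fderiv_subset ℝ
      intro h0
      apply hx
      simp [h0]
    have hs' : Function.support ψ ⊆ tsupport ψ := subset_tsupport ψ
    have hK : IsCompact (tsupport ψ) := h2
    simp only [Pi.add_apply, smul_add]
    rw [integral_add (integrable_smul_of_locInt h.locInt hc hK h3 hs)
        (integrable_smul_of_locInt h'.locInt hc hK h3 hs),
      integral_add (integrable_smul_of_locInt h.locInt_deriv h1.continuous hK h3 hs')
        (integrable_smul_of_locInt h'.locInt_deriv h1.continuous hK h3 hs'),
      h.integral_eq ψ h1 h2 h3, h'.integral_eq ψ h1 h2 h3, neg_add]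

lemma const_smul (c : ℂ) (h : HasWeakPartial U i φ G) : HasWeakPartial U i (c • φ) (c • G) where
  locInt K hK hKU := (h.locInt K hK hKU).smul c
  locInt_deriv K hK hKU := (h.locInt_deriv K hK hKU).smul c
  integral_eq ψ h1 h2 h3 := by
    simp only [Pi.smul_apply, smul_comm _ c]
    rw [integral_smul, integral_smul, h.integral_eq ψ h1 h2 h3, smul_neg]

end HasWeakPartial

/-- Complex-valued measurable functions on `U` modulo equality Lebesgue-almost everywhere: the
common ambient space of all function spaces on `U` considered here. -/
abbrev Fun (U : TopologicalSpace.Opens (E d)) : Type := E d →ₘ[volume.restrict (U : Set (E d))] ℂ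

/-- `L^p(U, ω, ℂ^m)`, with norm `(∑ i, ∫_U |φ_i|^p ω dx)^(1/p)` for `p < ∞`. -/
abbrev WLp (p : ℝ≥0∞) (ω : Weight U) (m : ℕ) : Type :=
  PiLp p fun _ : Fin m => Lp ℂ p ω.measure

lemma toFun_aesm {p : ℝ≥0∞} (ω : Weight U) (f : Lp ℂ p ω.measure) :
    AEStronglyMeasurable f (volume.restrict (U : Set (E d))) :=
  (Lp.aestronglyMeasurable f).mono_ac ω.ac_measure

variable (p : ℝ≥0∞) [Fact (1 ≤ p)]

/-- The weighted Sobolev space `W^{1,p}(U, ω)`: a function `φ` is identified with the element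
`(φ, ∇φ)` of `L^p(U, ω, ℂ^{d+1})`, and so has the norm of `(φ, ∇φ)` in that space. -/
def sobolevGraph (ω : Weight U) : Submodule ℂ (WLp p ω (d + 1)) where
  carrier := {F | ∀ i : Fin d, HasWeakPartial U i (F 0) (F i.succ)}
  zero_mem' _ := HasWeakPartial.zero.congr (ω.ac_measure.ae_eq (Lp.coeFn_zero ℂ p ω.measure)).symm
    (ω.ac_measure.ae_eq (Lp.coeFn_zero ℂ p ω.measure)).symm
  add_mem' {F G} hF hG i := ((hF i).add (hG i)).congr
    (ω.ac_measure.ae_eq (Lp.coeFn_add (F 0) (G 0))).symm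
    (ω.ac_measure.ae_eq (Lp.coeFn_add (F i.succ) (G i.succ))).symm
  smul_mem' c F hF i := ((hF i).const_smul c).congr
    (ω.ac_measure.ae_eq (Lp.coeFn_smul c (F 0))).symm
    (ω.ac_measure.ae_eq (Lp.coeFn_smul c (F i.succ))).symm

/-- The normed space `W^{1,p}(U, ω)`. -/
def Sobolev (ω : Weight U) : Type := sobolevGraph p ω

instance (ω : Weight U) : NormedAddCommGroup (Sobolev p ω) :=
  inferInstanceAs (NormedAddCommGroup (sobolevGraph p ω))

instance (ω : Weight U) : NormedSpace ℂ (Sobolev p ω) :=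
  inferInstanceAs (NormedSpace ℂ (sobolevGraph p ω))

/-- The inclusion `(φ, ∇φ) ↦ φ` of `W^{1,p}(U, ω)` in the space of functions on `U`. -/
def sobolevIncl (ω : Weight U) : Sobolev p ω →ₗ[ℂ] Fun U where
  toFun F := AEEqFun.mk (F.1 0) (toFun_aesm ω (F.1 0))
  map_add' F G := by
    rw [AEEqFun.mk_add_mk, AEEqFun.mk_eq_mk]
    exact ω.ac_measure.ae_eq (Lp.coeFn_add (F.1 0) (G.1 0))
  map_smul' c F := by
    rw [RingHom.id_apply, AEEqFun.smul_mk, AEEqFun.mk_eq_mk]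
    exact ω.ac_measure.ae_eq (Lp.coeFn_smul c (F.1 0))

/-- `Lip_c(U)`: Lipschitz functions with compact support in `U` (extended by zero outside `U`),
as elements of the ambient space. -/
def lipC (U : TopologicalSpace.Opens (E d)) : Submodule ℂ (Fun U) where
  carrier := {v | ∃ φ : E d → ℂ, (∃ C : ℝ≥0, LipschitzWith C φ) ∧ HasCompactSupport φ ∧
    tsupport φ ⊆ U ∧ v =ᵐ[volume.restrict (U : Set (E d))] φ}
  zero_mem' := ⟨0, ⟨0, LipschitzWith.const 0⟩, HasCompactSupport.zero, by simp [tsupport],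
    AEEqFun.coeFn_zero⟩
  add_mem' := by
    rintro v w ⟨φ, ⟨C, hC⟩, hc, hs, hv⟩ ⟨ψ, ⟨D, hD⟩, hc', hs', hw⟩
    exact ⟨φ + ψ, ⟨C + D, hC.add hD⟩, hc.add hc',
      (tsupport_add φ ψ).trans (Set.union_subset hs hs'),
      (AEEqFun.coeFn_add v w).trans (hv.add hw)⟩
  smul_mem' := by
    rintro c v ⟨φ, ⟨C, hC⟩, hc, hs, hv⟩
    have hsub : tsupport (c • φ) ⊆ tsupport φ := by
      apply closure_mono
      intro x hx h0
      apply hx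
      simp [h0]
    exact ⟨c • φ, ⟨‖c‖₊ * C, (lipschitzWith_smul c).comp hC⟩,
      hc.mono' ((subset_tsupport _).trans hsub), hsub.trans hs,
      (AEEqFun.coeFn_smul c v).trans (hv.const_smul c)⟩

/-- `W_0^{1,p}(U, ω)`: the closure of `Lip_c(U)` in `W^{1,p}(U, ω)`, with the same norm. -/
def sobolevZero (ω : Weight U) : Submodule ℂ (Sobolev p ω) :=
  ((lipC U).comap (sobolevIncl p ω)).topologicalClosure

/-- The inclusion of `W_0^{1,p}(U, ω)` in the space of functions on `U`. -/
def sobolevZeroIncl (ω : Weight U) : sobolevZero p ω →ₗ[ℂ] Fun U :=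
  (sobolevIncl p ω) ∘ₗ (sobolevZero p ω).subtype

/-- The space `𝒲^p(U, θ, r_ω)` of those `φ ∈ W^{1,p}(U, ω_θ)` for which
`φ |∇ log r_ω| ∈ L^p(U, ω_θ)`: a function `φ` is identified with the pair `(φ, φ |∇ log r_ω|)`, and
so has the norm `(‖φ‖^p + ∫_U |φ|^p |∇ log r_ω|^p ω_θ dx)^(1/p)` for `p < ∞`. -/
def calW (ω₀ ω₁ : Weight U) (θ : ℝ) :
    Submodule ℂ (WithLp p (Sobolev p (ω₀.interp ω₁ θ) × Lp ℂ p (ω₀.interp ω₁ θ).measure)) where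
  carrier := {P | P.snd =ᵐ[(ω₀.interp ω₁ θ).measure] fun x =>
    ‖gradient (fun y => Real.log (ω₀.ratio ω₁ y)) x‖ • P.fst.1 0 x}
  zero_mem' := by
    filter_upwards [Lp.coeFn_zero ℂ p (ω₀.interp ω₁ θ).measure] with x hx
    change (0 : Lp ℂ p (ω₀.interp ω₁ θ).measure) x =
      _ • (0 : Lp ℂ p (ω₀.interp ω₁ θ).measure) x
    rw [hx]
    simp
  add_mem' := by
    intro P Q hP hQ
    filter_upwards [hP, hQ, Lp.coeFn_add P.snd Q.snd,
      Lp.coeFn_add (P.fst.1 0) (Q.fst.1 0)] with x h1 h2 h3 h4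
    change (P.snd + Q.snd : Lp ℂ p (ω₀.interp ω₁ θ).measure) x =
      _ • (P.fst.1 0 + Q.fst.1 0 : Lp ℂ p (ω₀.interp ω₁ θ).measure) x
    rw [h3, h4, Pi.add_apply, Pi.add_apply, h1, h2, smul_add]
  smul_mem' := by
    intro c P hP
    filter_upwards [hP, Lp.coeFn_smul c P.snd, Lp.coeFn_smul c (P.fst.1 0)] with x h1 h3 h4
    change (c • P.snd : Lp ℂ p (ω₀.interp ω₁ θ).measure) x =
      _ • (c • P.fst.1 0 : Lp ℂ p (ω₀.interp ω₁ θ).measure) x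
    rw [h3, h4, Pi.smul_apply, Pi.smul_apply, h1, smul_comm]

/-- The inclusion of `𝒲^p(U, θ, r_ω)` in the space of functions on `U`. -/
def calWIncl (ω₀ ω₁ : Weight U) (θ : ℝ) : calW p ω₀ ω₁ θ →ₗ[ℂ] Fun U where
  toFun P := sobolevIncl p (ω₀.interp ω₁ θ) P.1.fst
  map_add' P Q := map_add (sobolevIncl p (ω₀.interp ω₁ θ)) P.1.fst Q.1.fst
  map_smul' c P := map_smul (sobolevIncl p (ω₀.interp ω₁ θ)) c P.1.fst

/-- `𝒲_0^p(U, θ, r_ω)`: the closure of `Lip_c(U)` in `𝒲^p(U, θ, r_ω)`. -/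
def calWZero (ω₀ ω₁ : Weight U) (θ : ℝ) : Submodule ℂ (calW p ω₀ ω₁ θ) :=
  ((lipC U).comap (calWIncl p ω₀ ω₁ θ)).topologicalClosure

/-- Every `φ ∈ W_0^{1,p}(U, ω₀) ∩ W_0^{1,p}(U, ω₁)` is the limit, in one of the spaces
`W^{1,p}(U, ω₀)` and `W^{1,p}(U, ω₁)`, of a sequence in `Lip_c(U)` that is bounded in the other. -/
def SimultaneousApprox (ω₀ ω₁ : Weight U) : Prop :=
  ∀ (F₀ : Sobolev p ω₀) (F₁ : Sobolev p ω₁), F₀ ∈ sobolevZero p ω₀ → F₁ ∈ sobolevZero p ω₁ →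
    sobolevIncl p ω₀ F₀ = sobolevIncl p ω₁ F₁ →
    ∃ (G₀ : ℕ → Sobolev p ω₀) (G₁ : ℕ → Sobolev p ω₁),
      (∀ n, sobolevIncl p ω₀ (G₀ n) = sobolevIncl p ω₁ (G₁ n) ∧
        sobolevIncl p ω₀ (G₀ n) ∈ lipC U) ∧
      ((Tendsto G₀ atTop (𝓝 F₀) ∧ ∃ B : ℝ, ∀ n, ‖G₁ n‖ ≤ B) ∨
        (Tendsto G₁ atTop (𝓝 F₁) ∧ ∃ B : ℝ, ∀ n, ‖G₀ n‖ ≤ B))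

end WSob

end

open Set Filter Topology MeasureTheory
open scoped NNReal ENNReal

noncomputable section

/-! Multiplication by e^{κg/p} is an isometry of L^p that trades the weight e^{κg}ω for ω. Since ∇g
is bounded, it alters the gradient of φ, apart from the same scaling, only by a bounded multiple of
φ. Sobolev spaces whose weights differ by powers of e^g therefore interpolate like weighted L^p
spaces.

For φ in W^{1,p}(U, ω_θ) put f(z) = e^{z²-θ²} e^{(z-θ)g/p} φ, so that f(θ) = φ. As ω₀ = ω_θ e^{θg}
and ω₁ = ω_θ e^{(θ-1)g}, the values on Re z = j are bounded in W^{1,p}(U, ω_j): the gradient brings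
down (z-θ)∇g/p, and the Gaussian decay of e^{z²} in Im z absorbs this linear growth. Inside the
strip f(z) need not lie in either space, but with the logistic function s(t) = 1/(1+e^t) the pieces
s(g)f(z) and (1-s(g))f(z) lie in W^{1,p}(U, ω₀) and W^{1,p}(U, ω₁). Their analyticity follows from
Cauchy estimates and dominated convergence (`exists_mulFamily`,
`exists_calderonFunction_of_sobolev`).

Conversely, for a Calderón function f the three lines theorem is applied to e^{(1-z)g/p} times each
component (the function and its weak partial derivatives), as in Stein-Weiss interpolation. On Re z
= j the factor turns the unweighted bound into the one for ω_j, and at z = θ into the one for ω_θ.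
As g may be unbounded, this is done on {|g| ≤ n}, with a bound independent of n
(`CalderonFunction.eLpNorm_le`, `exists_sobolev_of_calderonFunction`).

For W_0^{1,p} two further facts enter: multipliers that are Lipschitz on balls preserve the closure
of Lip_c (`IsMul.mem_sobolevZero`), and a sum of elements of the two endpoint closures that lies in
W^{1,p}(U, ω_θ) lies in W_0^{1,p}(U, ω_θ), by cutoffs (`mem_sobolevZero_of_eq_add`). Both kinds of
spaces are instances of `eqUpToEquivNorms_of_mulStable`. The claims on the weights themselves hold
because g is bounded on compact sets and ω₀/ω₁ = e^g. -/

/-- Postcomposition with a continuous linear map preserves differentiability, also between spaces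
that are only seminormed. -/
lemma DifferentiableWithinAt.clm_comp_of_seminormed {E F : Type*} [SeminormedAddCommGroup E]
    [NormedSpace ℂ E] [SeminormedAddCommGroup F] [NormedSpace ℂ F] (T : E →L[ℂ] F) {f : ℂ → E}
    {s : Set ℂ} {z : ℂ} (hf : DifferentiableWithinAt ℂ f s z) :
    DifferentiableWithinAt ℂ (fun w => T (f w)) s z := by
  obtain ⟨f', hf'⟩ := hf
  refine ⟨T.comp f', ?_⟩
  -- The quotient `SumSpace` carries only a seminorm, since the kernel of `sumMap` is not assumed
  -- closed. As a little-o estimate in seminorms, differentiability survives `T` at the cost of a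
  -- factor ‖T‖.
  rw [HasFDerivWithinAt, hasFDerivAtFilter_iff_isLittleOTVS] at hf' ⊢
  rw [Asymptotics.isLittleOTVS_iff_isLittleO] at hf' ⊢
  refine Asymptotics.IsBigO.trans_isLittleO (Asymptotics.IsBigO.of_bound ‖T‖ ?_) hf'
  refine Eventually.of_forall fun w => ?_
  have := T.le_opNorm (f w.1 - f w.2 - f' (w.1 - w.2))
  simpa using this

/-! ### The sum space and the construction of Calderón functions. -/

namespace ComplexInterp

variable {V A₀ A₁ : Type*} [AddCommGroup V] [Module ℂ V]
  [NormedAddCommGroup A₀] [NormedSpace ℂ A₀] [NormedAddCommGroup A₁] [NormedSpace ℂ A₁]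
  {ι₀ : A₀ →ₗ[ℂ] V} {ι₁ : A₁ →ₗ[ℂ] V}

variable (ι₀ ι₁) in
/-- The quotient map `(a₀, a₁) ↦ a₀ + a₁` onto `A₀ + A₁`. -/
def SumSpace.mkL : WithLp 1 (A₀ × A₁) →L[ℂ] SumSpace ι₀ ι₁ where
  toLinearMap := (LinearMap.ker (sumMap ι₀ ι₁)).mkQ
  cont := continuous_quot_mk

lemma SumSpace.toAmbient_mkL (a : WithLp 1 (A₀ × A₁)) :
    SumSpace.toAmbient ι₀ ι₁ (SumSpace.mkL ι₀ ι₁ a) = ι₀ a.fst + ι₁ a.snd := rfl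

lemma SumSpace.toAmbient_injective : Function.Injective (SumSpace.toAmbient ι₀ ι₁) := by
  rw [← LinearMap.ker_eq_bot]
  exact Submodule.ker_liftQ_eq_bot _ _ _ le_rfl

lemma SumSpace.exists_mkL_eq (x : SumSpace ι₀ ι₁) : ∃ a, SumSpace.mkL ι₀ ι₁ a = x :=
  Submodule.mkQ_surjective _ x

lemma SumSpace.norm_mkL_le (a : WithLp 1 (A₀ × A₁)) :
    ‖SumSpace.mkL ι₀ ι₁ a‖ ≤ ‖a.fst‖ + ‖a.snd‖ := by
  refine (Submodule.Quotient.norm_mk_le _ _).trans_eq ?_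
  rw [WithLp.prod_norm_eq_of_L1]

/-- A compatible pair of bounded linear maps on `A₀` and `A₁` extends to `A₀ + A₁`. -/
def SumSpace.lift {B : Type*} [NormedAddCommGroup B] [NormedSpace ℂ B]
    (T₀ : A₀ →L[ℂ] B) (T₁ : A₁ →L[ℂ] B)
    (h : ∀ a b, ι₀ a + ι₁ b = 0 → T₀ a + T₁ b = 0) : SumSpace ι₀ ι₁ →L[ℂ] B where
  toLinearMap := (LinearMap.ker (sumMap ι₀ ι₁)).liftQ
    ((T₀.toLinearMap.coprod T₁.toLinearMap) ∘ₗ (WithLp.linearEquiv 1 ℂ (A₀ × A₁)).toLinearMap)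
    (fun a ha => h a.fst a.snd ha)
  cont := by
    refine continuous_quot_lift _ ?_
    change Continuous fun a : WithLp 1 (A₀ × A₁) => T₀ a.fst + T₁ a.snd
    fun_prop

lemma SumSpace.lift_mkL {B : Type*} [NormedAddCommGroup B] [NormedSpace ℂ B]
    (T₀ : A₀ →L[ℂ] B) (T₁ : A₁ →L[ℂ] B)
    (h : ∀ a b, ι₀ a + ι₁ b = 0 → T₀ a + T₁ b = 0) (a : WithLp 1 (A₀ × A₁)) :
    SumSpace.lift T₀ T₁ h (SumSpace.mkL ι₀ ι₁ a) = T₀ a.fst + T₁ a.snd := rfl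

lemma SumSpace.lift_inl {B : Type*} [NormedAddCommGroup B] [NormedSpace ℂ B]
    (T₀ : A₀ →L[ℂ] B) (T₁ : A₁ →L[ℂ] B)
    (h : ∀ a b, ι₀ a + ι₁ b = 0 → T₀ a + T₁ b = 0) (a : A₀) :
    SumSpace.lift T₀ T₁ h (SumSpace.inl ι₀ ι₁ a) = T₀ a := by
  change T₀ a + T₁ 0 = _
  simp

lemma SumSpace.lift_inr {B : Type*} [NormedAddCommGroup B] [NormedSpace ℂ B]
    (T₀ : A₀ →L[ℂ] B) (T₁ : A₁ →L[ℂ] B)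
    (h : ∀ a b, ι₀ a + ι₁ b = 0 → T₀ a + T₁ b = 0) (a : A₁) :
    SumSpace.lift T₀ T₁ h (SumSpace.inr ι₀ ι₁ a) = T₁ a := by
  change T₀ 0 + T₁ a = _
  simp

lemma SumSpace.toAmbient_inl (a : A₀) :
    SumSpace.toAmbient ι₀ ι₁ (SumSpace.inl ι₀ ι₁ a) = ι₀ a := by
  change ι₀ a + ι₁ 0 = _
  simp

lemma SumSpace.toAmbient_inr (a : A₁) :
    SumSpace.toAmbient ι₀ ι₁ (SumSpace.inr ι₀ ι₁ a) = ι₁ a := by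
  change ι₀ 0 + ι₁ a = _
  simp

lemma interior_strip : interior strip = Complex.re ⁻¹' Ioo 0 1 := by
  have : strip = Complex.re ⁻¹' Icc 0 1 := rfl
  rw [this, Complex.interior_preimage_re, interior_Icc]

/-- Two continuous families, in `A₀` and `A₁`, that are analytic inside the strip and bounded,
together with the boundary values of their sum, define a Calderon function. -/
lemma exists_calderonFunction (F₀ : ℂ → A₀) (F₁ : ℂ → A₁) (B₀ : ℂ → A₀) (B₁ : ℂ → A₁) {C : ℝ}
    (hC : 0 ≤ C)
    (hc₀ : ContinuousOn F₀ strip) (hc₁ : ContinuousOn F₁ strip)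
    (hd₀ : DifferentiableOn ℂ F₀ (interior strip)) (hd₁ : DifferentiableOn ℂ F₁ (interior strip))
    (hb₀ : ∀ z ∈ strip, ‖F₀ z‖ ≤ C) (hb₁ : ∀ z ∈ strip, ‖F₁ z‖ ≤ C)
    (hB₀ : ContinuousOn B₀ {z | z.re = 0}) (hB₁ : ContinuousOn B₁ {z | z.re = 1})
    (hBb₀ : ∀ z : ℂ, z.re = 0 → ‖B₀ z‖ ≤ C) (hBb₁ : ∀ z : ℂ, z.re = 1 → ‖B₁ z‖ ≤ C)
    (he₀ : ∀ z : ℂ, z.re = 0 → ι₀ (F₀ z) + ι₁ (F₁ z) = ι₀ (B₀ z))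
    (he₁ : ∀ z : ℂ, z.re = 1 → ι₀ (F₀ z) + ι₁ (F₁ z) = ι₁ (B₁ z)) :
    ∃ f : CalderonFunction ι₀ ι₁, f.norm ≤ C ∧
      ∀ z, SumSpace.toAmbient ι₀ ι₁ (f.toFun z) = ι₀ (F₀ z) + ι₁ (F₁ z) := by
  have e : ∀ a b, (WithLp.toLp 1 (a, b) : WithLp 1 (A₀ × A₁)) =
      (WithLp.prodContinuousLinearEquiv 1 ℂ A₀ A₁).symm (a, b) := fun _ _ => rfl
  -- On Re z = 0 the piece `F₁ z` need not lie in A₀, although the sum does. `B₀` is that sum as an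
  -- A₀-valued family; its continuity in A₀ is separate information. Likewise for `B₁`.
  refine ⟨{ toFun := fun z => SumSpace.mkL ι₀ ι₁ (WithLp.toLp 1 (F₀ z, F₁ z))
            continuousOn := ?_
            bounded := ⟨C + C, fun z hz => (SumSpace.norm_mkL_le _).trans
              (add_le_add (hb₀ z hz) (hb₁ z hz))⟩
            differentiableOn := ?_
            bdry₀ := BoundedContinuousFunction.ofNormedAddCommGroup
              (fun t : ℝ => B₀ (t * Complex.I)) ?_ C fun t => hBb₀ _ (by simp)
            bdry₁ := BoundedContinuousFunction.ofNormedAddCommGroup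
              (fun t : ℝ => B₁ (1 + t * Complex.I)) ?_ C fun t => hBb₁ _ (by simp)
            toFun_bdry₀ := ?_
            toFun_bdry₁ := ?_ }, ?_, ?_⟩
  · simp only [e]
    exact (SumSpace.mkL ι₀ ι₁).continuous.comp_continuousOn
      ((ContinuousLinearEquiv.continuous _).comp_continuousOn (hc₀.prodMk hc₁))
  · intro z hz
    simp only [e]
    refine DifferentiableWithinAt.clm_comp_of_seminormed (SumSpace.mkL ι₀ ι₁) ?_
    exact DifferentiableWithinAt.clm_comp_of_seminormed
      (WithLp.prodContinuousLinearEquiv 1 ℂ A₀ A₁).symm.toContinuousLinearMap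
      ((hd₀ z hz).prodMk (hd₁ z hz))
  · exact hB₀.comp_continuous (by fun_prop) fun t => by simp
  · exact hB₁.comp_continuous (by fun_prop) fun t => by simp
  · intro t
    apply SumSpace.toAmbient_injective
    rw [SumSpace.toAmbient_mkL, SumSpace.toAmbient_inl]
    exact he₀ _ (by simp)
  · intro t
    apply SumSpace.toAmbient_injective
    rw [SumSpace.toAmbient_mkL, SumSpace.toAmbient_inr]
    exact he₁ _ (by simp)
  · refine max_le ?_ ?_
    · exact (BoundedContinuousFunction.norm_le hC).2 fun t => hBb₀ _ (by simp)
    · exact (BoundedContinuousFunction.norm_le hC).2 fun t => hBb₁ _ (by simp)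
  · intro z
    rfl

lemma CalderonFunction.norm_nonneg (f : CalderonFunction ι₀ ι₁) : 0 ≤ f.norm :=
  le_max_of_le_left (_root_.norm_nonneg _)

/-- A two-sided estimate that identifies the complex interpolation space. -/
lemma eqUpToEquivNorms_of_bounds {θ : ℝ} {A : Type*} [NormedAddCommGroup A] [NormedSpace ℂ A]
    (ι : A →ₗ[ℂ] V) (hι : Function.Injective ι) {c C : ℝ} (hc : 0 < c) (hC : 0 < C)
    (h₁ : ∀ f : CalderonFunction ι₀ ι₁, ∃ a : A,
      ι a = SumSpace.toAmbient ι₀ ι₁ (f.toFun θ) ∧ c * ‖a‖ ≤ f.norm)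
    (h₂ : ∀ a : A, ∃ f : CalderonFunction ι₀ ι₁,
      SumSpace.toAmbient ι₀ ι₁ (f.toFun θ) = ι a ∧ f.norm ≤ C * ‖a‖) :
    EqUpToEquivNorms ι₀ ι₁ θ ι := by
  refine ⟨?_, c, C, hc, hC, fun a => ⟨?_, ?_⟩⟩
  · ext v
    constructor
    · rintro ⟨f, rfl⟩
      obtain ⟨a, ha, -⟩ := h₁ f
      exact ⟨a, ha⟩
    · rintro ⟨a, rfl⟩
      obtain ⟨f, hf, -⟩ := h₂ a
      exact ⟨f, hf⟩
  -- Even the lower bound needs `h₂`: the set of norms must be nonempty, because `sInf ∅ = 0`.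
  · obtain ⟨f, hf, -⟩ := h₂ a
    refine le_csInf ⟨_, f, hf, rfl⟩ ?_
    rintro r ⟨f, hf, rfl⟩
    obtain ⟨b, hb, hb'⟩ := h₁ f
    rwa [← hι (hb.trans hf)]
  · obtain ⟨f, hf, hf'⟩ := h₂ a
    refine le_trans (csInf_le ⟨0, ?_⟩ ⟨f, hf, rfl⟩) hf'
    rintro r ⟨f, -, rfl⟩
    exact f.norm_nonneg

end ComplexInterp

/-! ### L^p spaces: exponential weights and multiplication by bounded continuous functions. -/

section Lp

variable {X : Type*} [MeasurableSpace X] {p : ℝ≥0∞}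

/-- A density e^G acts on the L^p norm through its p-th root. This brings all weighted norms over
one measure. -/
lemma eLpNorm_withDensity_exp {μ : Measure X} (hp0 : p ≠ 0) (hp : p ≠ ∞) {G : X → ℝ}
    (hG : AEMeasurable G μ) {h : X → ℂ} (hh : AEStronglyMeasurable h μ) :
    eLpNorm h p (μ.withDensity fun x => ENNReal.ofReal (Real.exp (G x))) =
      eLpNorm (fun x => Real.exp (G x / p.toReal) • h x) p μ := by
  have hpos : 0 < p.toReal := ENNReal.toReal_pos hp0 hp
  rw [eLpNorm_eq_lintegral_rpow_enorm_toReal hp0 hp, eLpNorm_eq_lintegral_rpow_enorm_toReal hp0 hp,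
    lintegral_withDensity_eq_lintegral_mul₀ (by fun_prop) (hh.enorm.pow_const _)]
  congr 1
  refine lintegral_congr fun x => ?_
  simp only [Pi.mul_apply]
  rw [enorm_smul, ENNReal.mul_rpow_of_nonneg _ _ hpos.le,
    Real.enorm_eq_ofReal (Real.exp_pos _).le, ENNReal.ofReal_rpow_of_pos (Real.exp_pos _),
    ← Real.exp_mul, div_mul_cancel₀ _ hpos.ne']

/-- Monotone convergence along the sets {|G| ≤ n}, which exhaust the space. It allows an unbounded
exponent to be replaced by bounded truncations. -/
lemma eLpNorm_le_of_forall_restrict {μ : Measure X} (hp0 : p ≠ 0) (hp : p ≠ ∞) {G : X → ℝ}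
    {h : X → ℂ} {C : ℝ≥0∞}
    (H : ∀ n : ℕ, eLpNorm h p (μ.restrict {x | |G x| ≤ n}) ≤ C) : eLpNorm h p μ ≤ C := by
  have hpos : 0 < p.toReal := ENNReal.toReal_pos hp0 hp
  have hm : Monotone fun n : ℕ => {x | |G x| ≤ n} := by
    intro m n hmn x hx
    exact le_trans (show |G x| ≤ m from hx) (by exact_mod_cast hmn)
  have hU : (⋃ n : ℕ, {x | |G x| ≤ n}) = univ := by
    refine eq_univ_of_forall fun x => ?_
    obtain ⟨n, hn⟩ := exists_nat_ge |G x|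
    exact mem_iUnion.2 ⟨n, hn⟩
  have key : ∫⁻ x, ‖h x‖ₑ ^ p.toReal ∂μ ≤ C ^ p.toReal := by
    rw [← setLIntegral_univ, ← hU,
      setLIntegral_iUnion_of_directed _ (directed_of_isDirected_le hm)]
    refine iSup_le fun n => ?_
    have := H n
    rw [eLpNorm_eq_lintegral_rpow_enorm_toReal hp0 hp, one_div,
      ENNReal.rpow_inv_le_iff hpos] at this
    exact this
  rw [eLpNorm_eq_lintegral_rpow_enorm_toReal hp0 hp, one_div, ENNReal.rpow_inv_le_iff hpos]
  exact key

/-- The identity as a bounded map between the `L^p` spaces of two measures. -/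
def Lp.changeMeasure [Fact (1 ≤ p)] {μ ν : Measure X} (hac : ν ≪ μ) (C : ℝ≥0)
    (hC : ∀ h : X → ℂ, AEStronglyMeasurable h μ → eLpNorm h p ν ≤ C * eLpNorm h p μ) :
    Lp ℂ p μ →L[ℂ] Lp ℂ p ν :=
  have hmem : ∀ h : Lp ℂ p μ, MemLp h p ν := fun h =>
    ⟨(Lp.aestronglyMeasurable h).mono_ac hac, (hC h (Lp.aestronglyMeasurable h)).trans_lt
      (ENNReal.mul_lt_top ENNReal.coe_lt_top (Lp.eLpNorm_lt_top h))⟩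
  LinearMap.mkContinuous
    { toFun := fun h => (hmem h).toLp h
      map_add' := fun h k => by
        rw [← MemLp.toLp_add, MemLp.toLp_eq_toLp_iff]
        exact hac.ae_eq (Lp.coeFn_add h k)
      map_smul' := fun c h => by
        rw [RingHom.id_apply, ← MemLp.toLp_const_smul, MemLp.toLp_eq_toLp_iff]
        exact hac.ae_eq (Lp.coeFn_smul c h) } C fun h => by
    change ‖(hmem h).toLp h‖ ≤ C * ‖h‖
    rw [Lp.norm_toLp, Lp.norm_def, ← ENNReal.coe_toReal, ← ENNReal.toReal_mul]
    exact ENNReal.toReal_mono (ENNReal.mul_lt_top ENNReal.coe_lt_top (Lp.eLpNorm_lt_top h)).ne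
      (hC h (Lp.aestronglyMeasurable h))

lemma Lp.changeMeasure_ae [Fact (1 ≤ p)] {μ ν : Measure X} (hac : ν ≪ μ) (C : ℝ≥0)
    (hC : ∀ h : X → ℂ, AEStronglyMeasurable h μ → eLpNorm h p ν ≤ C * eLpNorm h p μ)
    (h : Lp ℂ p μ) : Lp.changeMeasure hac C hC h =ᵐ[ν] h :=
  MemLp.coeFn_toLp (f := h) ⟨(Lp.aestronglyMeasurable h).mono_ac hac,
    (hC h (Lp.aestronglyMeasurable h)).trans_lt
      (ENNReal.mul_lt_top ENNReal.coe_lt_top (Lp.eLpNorm_lt_top h))⟩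

open scoped BoundedContinuousFunction

variable [TopologicalSpace X] [OpensMeasurableSpace X]

lemma BoundedContinuousFunction.memLp_mul {ν : Measure X} (b : X →ᵇ ℂ) {h : X → ℂ}
    (hh : MemLp h p ν) : MemLp (fun x => b x * h x) p ν :=
  hh.of_le_mul (c := ‖b‖) (b.continuous.aestronglyMeasurable.mul hh.1)
    (Eventually.of_forall fun x => by
      rw [norm_mul]
      exact mul_le_mul_of_nonneg_right (b.norm_coe_le_norm x) (norm_nonneg _))

/-- Multiplication of `L^p` functions by bounded continuous functions. -/
def Lp.mulBCF [Fact (1 ≤ p)] (ν : Measure X) : (X →ᵇ ℂ) →L[ℂ] Lp ℂ p ν →L[ℂ] Lp ℂ p ν :=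
  LinearMap.mkContinuous₂
    (LinearMap.mk₂ ℂ (fun b (h : Lp ℂ p ν) => (b.memLp_mul (Lp.memLp h)).toLp _)
      (fun b c h => by
        rw [← MemLp.toLp_add, MemLp.toLp_eq_toLp_iff]
        exact Eventually.of_forall fun x => by simp [add_mul])
      (fun c b h => by
        rw [← MemLp.toLp_const_smul, MemLp.toLp_eq_toLp_iff]
        exact Eventually.of_forall fun x => by simp [mul_assoc])
      (fun b h k => by
        rw [← MemLp.toLp_add, MemLp.toLp_eq_toLp_iff]
        filter_upwards [Lp.coeFn_add h k] with x hx
        rw [hx, Pi.add_apply, Pi.add_apply, mul_add])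
      (fun c b h => by
        rw [← MemLp.toLp_const_smul, MemLp.toLp_eq_toLp_iff]
        filter_upwards [Lp.coeFn_smul c h] with x hx
        rw [hx, Pi.smul_apply, Pi.smul_apply, smul_eq_mul, smul_eq_mul, mul_left_comm]))
    1 fun b h => by
      change ‖(b.memLp_mul (Lp.memLp h)).toLp _‖ ≤ _
      rw [one_mul]
      refine Lp.norm_le_mul_norm_of_ae_le_mul ?_
      filter_upwards [(b.memLp_mul (Lp.memLp h)).coeFn_toLp] with x hx
      rw [hx, norm_mul]
      exact mul_le_mul_of_nonneg_right (b.norm_coe_le_norm x) (norm_nonneg _)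

lemma Lp.mulBCF_ae [Fact (1 ≤ p)] {ν : Measure X} (b : X →ᵇ ℂ) (h : Lp ℂ p ν) :
    Lp.mulBCF ν b h =ᵐ[ν] fun x => b x * h x :=
  (b.memLp_mul (Lp.memLp h)).coeFn_toLp

/-- Evaluation at a point is a continuous ring homomorphism, so it commutes with exponentials. The
exponential in the Banach algebra of bounded functions makes z ↦ e^{(1-z)α} entire for the sup norm.
-/
lemma BoundedContinuousFunction.exp_apply {X : Type*} [TopologicalSpace X] (b : X →ᵇ ℂ) (x : X) :
    NormedSpace.exp b x = Complex.exp (b x) := by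
  let _ : NormedAlgebra ℚ (X →ᵇ ℂ) := NormedAlgebra.restrictScalars ℚ ℂ (X →ᵇ ℂ)
  let e : (X →ᵇ ℂ) →+* ℂ :=
    { toFun := fun b => b x, map_one' := rfl, map_mul' := fun _ _ => rfl, map_zero' := rfl,
      map_add' := fun _ _ => rfl }
  have he : Continuous e := (BoundedContinuousFunction.evalCLM ℂ x).continuous
  rw [Complex.exp_eq_exp_ℂ]
  exact NormedSpace.map_exp e he b

end Lp

/-! ### The three lines theorem and Stein-Weiss interpolation. -/

namespace ComplexInterp

open scoped BoundedContinuousFunction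

variable {V A₀ A₁ : Type*} [AddCommGroup V] [Module ℂ V]
  [NormedAddCommGroup A₀] [NormedSpace ℂ A₀] [NormedAddCommGroup A₁] [NormedSpace ℂ A₁]
  {ι₀ : A₀ →ₗ[ℂ] V} {ι₁ : A₁ →ₗ[ℂ] V}

/-- The three lines theorem for an operator-weighted Calderon function. -/
lemma CalderonFunction.norm_le_of_bdry {B : Type*} [NormedAddCommGroup B] [NormedSpace ℂ B]
    (f : CalderonFunction ι₀ ι₁) (R : SumSpace ι₀ ι₁ →L[ℂ] B) {M : ℂ → B →L[ℂ] B}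
    (hM : Differentiable ℂ M) {D : ℝ} (hD : ∀ z ∈ strip, ‖M z‖ ≤ D)
    (h₀ : ∀ t : ℝ, ‖M (t * Complex.I) (R (SumSpace.inl ι₀ ι₁ (f.bdry₀ t)))‖ ≤ f.norm)
    (h₁ : ∀ t : ℝ, ‖M (1 + t * Complex.I) (R (SumSpace.inr ι₀ ι₁ (f.bdry₁ t)))‖ ≤ f.norm)
    {z : ℂ} (hz : z ∈ strip) : ‖M z (R (f.toFun z))‖ ≤ f.norm := by
  obtain ⟨K, hK⟩ := f.bounded
  have hint : Complex.re ⁻¹' Ioo 0 1 ⊆ strip := fun z hz => ⟨hz.1.le, hz.2.le⟩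
  refine PhragmenLindelof.vertical_strip (a := 0) (b := 1) (C := f.norm)
    (f := fun z => M z (R (f.toFun z))) ⟨?_, ?_⟩ ?_ ?_ ?_ hz.1 hz.2
  · intro z hz
    rw [← interior_strip] at hz
    refine ((hM z).differentiableWithinAt).clm_apply ?_
    rw [← interior_strip]
    exact (f.differentiableOn z hz).clm_comp_of_seminormed R
  · rw [Complex.closure_preimage_re, closure_Ioo (by norm_num)]
    exact hM.continuous.continuousOn.clm_apply (R.continuous.comp_continuousOn f.continuousOn)
  -- The function is bounded on the strip, so the growth condition holds with both exponents zero.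
  · refine ⟨0, by positivity, 0, ?_⟩
    refine Asymptotics.IsBigO.of_bound (D * (‖R‖ * K)) ?_
    filter_upwards [mem_inf_of_right (mem_principal_self _)] with z hz
    have hzs := hint hz
    simp only [zero_mul, Real.exp_zero, norm_one, mul_one]
    refine ((M z).le_opNorm _).trans ?_
    refine mul_le_mul (hD z hzs) ?_ (_root_.norm_nonneg _) ((_root_.norm_nonneg _).trans (hD z hzs))
    exact (R.le_opNorm _).trans (mul_le_mul_of_nonneg_left (hK z hzs) (_root_.norm_nonneg _))
  · intro z hz
    have : z = z.im * Complex.I := by apply Complex.ext <;> simp [hz]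
    rw [this]
    simp only [f.toFun_bdry₀]
    exact h₀ _
  · intro z hz
    have : z = 1 + z.im * Complex.I := by apply Complex.ext <;> simp [hz]
    rw [this]
    simp only [f.toFun_bdry₁]
    exact h₁ _

variable {X : Type*} [MeasurableSpace X] {p : ℝ≥0∞} [Fact (1 ≤ p)]
  [TopologicalSpace X] [OpensMeasurableSpace X]

/-- Stein-Weiss interpolation with change of measure: a pair of contractions into weighted `L^p`
spaces maps `[A₀, A₁]_θ` into the `L^p` space with the intermediate weight. -/
lemma CalderonFunction.eLpNorm_le (hp : p ≠ ∞) (f : CalderonFunction ι₀ ι₁) {g : X → ℝ}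
    (hg : Continuous g) {μ₀ μ₁ : Measure X}
    (hμ : μ₀ = μ₁.withDensity fun x => ENNReal.ofReal (Real.exp (g x)))
    (P₀ : A₀ →L[ℂ] Lp ℂ p μ₀) (P₁ : A₁ →L[ℂ] Lp ℂ p μ₁)
    (hP₀ : ∀ a, ‖P₀ a‖ ≤ ‖a‖) (hP₁ : ∀ a, ‖P₁ a‖ ≤ ‖a‖)
    (hP : ∀ a b, ι₀ a + ι₁ b = 0 → (fun x => P₀ a x + P₁ b x) =ᵐ[μ₁] 0)
    {θ : ℝ} (hθ : θ ∈ Icc (0 : ℝ) 1) {a : WithLp 1 (A₀ × A₁)}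
    (ha : SumSpace.mkL ι₀ ι₁ a = f.toFun θ) :
    eLpNorm (fun x => P₀ a.fst x + P₁ a.snd x) p
      (μ₁.withDensity fun x => ENNReal.ofReal (Real.exp ((1 - θ) * g x))) ≤
      ENNReal.ofReal f.norm := by
  have hp0 : p ≠ 0 := (zero_lt_one.trans_le (Fact.out : 1 ≤ p)).ne'
  have hpos : 0 < p.toReal := ENNReal.toReal_pos hp0 hp
  have hac : μ₁ ≪ μ₀ := by
    rw [hμ]
    exact withDensity_absolutelyContinuous' (by fun_prop)
      (Eventually.of_forall fun x => by simp [Real.exp_pos])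
  have hP₀m : ∀ a, AEStronglyMeasurable (P₀ a) μ₁ := fun a =>
    (Lp.aestronglyMeasurable (P₀ a)).mono_ac hac
  rw [eLpNorm_withDensity_exp (h := fun x => P₀ a.fst x + P₁ a.snd x) hp0 hp (by fun_prop)
    ((hP₀m _).add (Lp.aestronglyMeasurable (P₁ a.snd)))]
  refine eLpNorm_le_of_forall_restrict hp0 hp (G := g) fun n => ?_
  -- On `S` the two measures are comparable, so both L^p spaces map boundedly into the single space
  -- L^p(ν), where the three lines theorem can act.
  set S : Set X := {x | |g x| ≤ n} with hS
  have hSm : MeasurableSet S := measurableSet_le (by fun_prop) measurable_const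
  set ν := μ₁.restrict S with hν
  have hSae : ∀ᵐ x ∂ν, |g x| ≤ n := ae_restrict_mem hSm
  have hν₁ : ν ≪ μ₁ := Measure.absolutelyContinuous_of_le Measure.restrict_le_self
  -- the weight, truncated so as to be bounded
  let α : X →ᵇ ℂ := BoundedContinuousFunction.ofNormedAddCommGroup
    (fun x => ((max (-(n : ℝ)) (min (n : ℝ) (g x)) / p.toReal : ℝ) : ℂ)) (by fun_prop) (n / p.toReal) (by
      intro x
      rw [Complex.norm_real, norm_div, Real.norm_of_nonneg hpos.le, Real.norm_eq_abs]
      have hn : (0 : ℝ) ≤ n := n.cast_nonneg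
      gcongr
      rw [abs_le]
      exact ⟨le_max_left _ _, max_le (by linarith) (min_le_left _ _)⟩)
  have hα : ∀ᵐ x ∂ν, α x = ((g x / p.toReal : ℝ) : ℂ) := by
    filter_upwards [hSae] with x hx
    obtain ⟨h1, h2⟩ := abs_le.1 hx
    change ((max (-(n : ℝ)) (min (n : ℝ) (g x)) / p.toReal : ℝ) : ℂ) = _
    rw [min_eq_right h2, max_eq_right h1]
  have hnorm : ∀ z : ℂ, ∀ x, ‖NormedSpace.exp ((1 - z) • α) x‖ =
      Real.exp ((1 - z.re) * (max (-(n : ℝ)) (min (n : ℝ) (g x)) / p.toReal)) := by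
    intro z x
    rw [BoundedContinuousFunction.exp_apply, Complex.norm_exp]
    change Real.exp ((1 - z) * ((max (-(n : ℝ)) (min (n : ℝ) (g x)) / p.toReal : ℝ) : ℂ)).re = _
    rw [Complex.re_mul_ofReal]
    simp
  have hnormν : ∀ z : ℂ, ∀ᵐ x ∂ν, ‖NormedSpace.exp ((1 - z) • α) x‖ =
      Real.exp ((1 - z.re) * (g x / p.toReal)) := by
    intro z
    filter_upwards [hSae] with x hx
    obtain ⟨h1, h2⟩ := abs_le.1 hx
    rw [hnorm, min_eq_right h2, max_eq_right h1]
  -- On `S` the multiplier has modulus e^{(1-Re z)g/p}: the p-th root of dμ₀/dμ₁ on Re z = 0, and 1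
  -- on Re z = 1. Hence both boundary estimates hold without a constant.
  let M : ℂ → Lp ℂ p ν →L[ℂ] Lp ℂ p ν := fun z => Lp.mulBCF ν (NormedSpace.exp ((1 - z) • α))
  have hMd : Differentiable ℂ M := by
    have h1 : Differentiable ℂ fun z : ℂ => NormedSpace.exp ((1 - z) • α) := fun z =>
      ((hasDerivAt_exp_smul_const α (1 - z)).differentiableAt).comp z (by fun_prop)
    exact (Lp.mulBCF ν).differentiable.comp h1
  have hMb : ∀ z ∈ strip, ‖M z‖ ≤ ‖Lp.mulBCF (p := p) ν‖ * Real.exp (n / p.toReal) := by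
    intro z hz
    refine ((Lp.mulBCF ν).le_opNorm _).trans ?_
    gcongr
    rw [BoundedContinuousFunction.norm_le (Real.exp_pos _).le]
    intro x
    rw [hnorm, Real.exp_le_exp, mul_div_assoc']
    have hn : (0 : ℝ) ≤ n := n.cast_nonneg
    gcongr
    have h1 : max (-(n : ℝ)) (min n (g x)) ≤ n := max_le (by linarith) (min_le_left _ _)
    have h2 : 0 ≤ 1 - z.re := by linarith [hz.2]
    have h3 : 1 - z.re ≤ 1 := by linarith [hz.1]
    nlinarith
  have hle1 : ∀ h : X → ℂ, AEStronglyMeasurable h μ₁ →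
      eLpNorm h p ν ≤ (1 : ℝ≥0) * eLpNorm h p μ₁ := fun h _ => by
    rw [ENNReal.coe_one, one_mul]
    exact eLpNorm_mono_measure _ Measure.restrict_le_self
  have hexp : ∀ h : X → ℂ, AEStronglyMeasurable h μ₀ →
      eLpNorm (fun x => Real.exp (g x / p.toReal) • h x) p ν ≤ eLpNorm h p μ₀ := fun h hh => by
    rw [hμ, eLpNorm_withDensity_exp hp0 hp hg.aemeasurable (hh.mono_ac hac)]
    exact eLpNorm_mono_measure _ Measure.restrict_le_self
  -- This bound depends on n but serves only to make `T₀` continuous; the boundary estimate on Re z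
  -- = 0 uses the sharp `hexp`.
  have hle0 : ∀ h : X → ℂ, AEStronglyMeasurable h μ₀ →
      eLpNorm h p ν ≤ (Real.exp (n / p.toReal)).toNNReal * eLpNorm h p μ₀ := fun h hh => by
    refine le_trans ?_ (mul_le_mul_right (hexp h hh) _)
    refine eLpNorm_le_nnreal_smul_eLpNorm_of_ae_le_mul ?_ p
    filter_upwards [hSae] with x hx
    rw [← NNReal.coe_le_coe]
    simp only [coe_nnnorm, NNReal.coe_mul, Real.coe_toNNReal _ (Real.exp_pos _).le, norm_smul,
      Real.norm_of_nonneg (Real.exp_pos _).le]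
    rw [← mul_assoc, ← Real.exp_add, ← add_div]
    refine le_mul_of_one_le_left (_root_.norm_nonneg _) (Real.one_le_exp ?_)
    have := (abs_le.1 hx).1
    exact div_nonneg (by linarith) hpos.le
  let T₀ : A₀ →L[ℂ] Lp ℂ p ν := (Lp.changeMeasure (hν₁.trans hac) _ hle0).comp P₀
  let T₁ : A₁ →L[ℂ] Lp ℂ p ν := (Lp.changeMeasure hν₁ _ hle1).comp P₁
  have hT₀ : ∀ a, T₀ a =ᵐ[ν] P₀ a := fun a => Lp.changeMeasure_ae (hν₁.trans hac) _ hle0 (P₀ a)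
  have hT₁ : ∀ a, T₁ a =ᵐ[ν] P₁ a := fun a => Lp.changeMeasure_ae hν₁ _ hle1 (P₁ a)
  have hT : ∀ a b, ι₀ a + ι₁ b = 0 → T₀ a + T₁ b = 0 := by
    intro a b hab
    rw [Lp.eq_zero_iff_ae_eq_zero]
    filter_upwards [hT₀ a, hT₁ b, Lp.coeFn_add (T₀ a) (T₁ b), hν₁.ae_eq (hP a b hab)] with
      x h1 h2 h3 h4
    rw [h3, Pi.add_apply, h1, h2]
    exact h4
  have key := f.norm_le_of_bdry (SumSpace.lift T₀ T₁ hT) hMd hMb ?_ ?_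
    (z := θ) (by simpa [strip] using hθ)
  · rw [← ha, SumSpace.lift_mkL, Lp.norm_def] at key
    have key' := (ENNReal.le_ofReal_iff_toReal_le (Lp.eLpNorm_ne_top _) f.norm_nonneg).2 key
    refine le_trans (le_of_eq ?_) key'
    refine eLpNorm_congr_norm_ae ?_
    filter_upwards [Lp.mulBCF_ae (NormedSpace.exp ((1 - (θ : ℂ)) • α)) (T₀ a.fst + T₁ a.snd),
      hnormν θ, Lp.coeFn_add (T₀ a.fst) (T₁ a.snd), hT₀ a.fst, hT₁ a.snd] with x h1 h2 h3 h4 h5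
    rw [h1, norm_mul, h2, norm_smul, h3, Pi.add_apply, h4, h5,
      Real.norm_of_nonneg (Real.exp_pos _).le, Complex.ofReal_re, mul_div_assoc]
  · intro t
    rw [SumSpace.lift_inl]
    refine le_trans ?_ (((hP₀ _).trans (f.bdry₀.norm_coe_le_norm t)).trans (le_max_left _ _))
    rw [Lp.norm_def, Lp.norm_def]
    refine ENNReal.toReal_mono (Lp.eLpNorm_ne_top _) ?_
    refine le_trans (le_of_eq ?_) (hexp _ (Lp.aestronglyMeasurable _))
    refine eLpNorm_congr_norm_ae ?_
    filter_upwards [Lp.mulBCF_ae (NormedSpace.exp ((1 - (t * Complex.I : ℂ)) • α))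
      (T₀ (f.bdry₀ t)), hnormν (t * Complex.I), hT₀ (f.bdry₀ t)] with x h1 h2 h3
    rw [h1, norm_mul, h2, h3, norm_smul, Real.norm_of_nonneg (Real.exp_pos _).le]
    simp
  · intro t
    rw [SumSpace.lift_inr]
    refine le_trans ?_ (((hP₁ _).trans (f.bdry₁.norm_coe_le_norm t)).trans (le_max_right _ _))
    rw [Lp.norm_def, Lp.norm_def]
    refine ENNReal.toReal_mono (Lp.eLpNorm_ne_top _) ?_
    refine le_trans (le_of_eq ?_) (eLpNorm_mono_measure _ (Measure.restrict_le_self (s := S)))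
    refine eLpNorm_congr_norm_ae ?_
    filter_upwards [Lp.mulBCF_ae (NormedSpace.exp ((1 - (1 + t * Complex.I : ℂ)) • α))
      (T₁ (f.bdry₁ t)), hnormν (1 + t * Complex.I), hT₁ (f.bdry₁ t)] with x h1 h2 h3
    rw [h1, norm_mul, h2, h3]
    simp

end ComplexInterp

/-! ### Lipschitz test functions for weak derivatives. -/

namespace WSob

variable {d : ℕ} {U : TopologicalSpace.Opens (E d)}

open scoped Convolution in
/-- The line derivative of the mollification of a Lipschitz function is the mollification of the
line derivative. -/
lemma fderiv_normed_convolution_apply (ρ : ContDiffBump (0 : E d)) {η : E d → ℝ} {C : ℝ≥0}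
    (hη : LipschitzWith C η) (hc : HasCompactSupport η) (x v : E d) :
    fderiv ℝ (ρ.normed volume ⋆[ContinuousLinearMap.lsmul ℝ ℝ, volume] η) x v =
      (ρ.normed volume ⋆[ContinuousLinearMap.lsmul ℝ ℝ, volume] fun y => lineDeriv ℝ η y v) x := by
  have hf : ContDiff ℝ 1 (ρ.normed (volume : Measure (E d))) := ρ.contDiff_normed
  have hfc : HasCompactSupport (ρ.normed (volume : Measure (E d))) := ρ.hasCompactSupport_normed
  have hloc : LocallyIntegrable η volume := hη.continuous.locallyIntegrable
  rw [(hfc.hasFDerivAt_convolution_left _ hf hloc x).fderiv, convolution_eq_swap,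
    convolution_lsmul_swap]
  have hdc : Continuous (fderiv ℝ (ρ.normed (volume : Measure (E d)))) :=
    hf.continuous_fderiv one_ne_zero
  rw [ContinuousLinearMap.integral_apply]
  swap
  · have := (hfc.fderiv ℝ).convolutionExists_left
      ((ContinuousLinearMap.lsmul ℝ ℝ : ℝ →L[ℝ] ℝ →L[ℝ] ℝ).precompL (E d)) hdc hloc x
    exact this.integrable_swap
  obtain ⟨D, hD⟩ := hf.lipschitzWith_of_hasCompactSupport hfc one_ne_zero
  have hD' : LipschitzWith D fun s => ρ.normed (volume : Measure (E d)) (x - s) := by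
    have : LipschitzWith (D * 1) fun s => ρ.normed (volume : Measure (E d)) (x - s) :=
      hD.comp (LipschitzWith.of_dist_le_mul fun a b => by
        rw [NNReal.coe_one, one_mul, dist_sub_left])
    simpa using this
  -- Integration by parts between two Lipschitz functions. The direction is -v because s ↦ x - s
  -- reverses the derivative of the mollifier.
  have key := hD'.integral_lineDeriv_mul_eq (μ := volume) hη hc (-v)
  rw [neg_neg] at key
  convert key using 1
  · refine integral_congr_ae (Eventually.of_forall fun s => ?_)
    have h1 : HasFDerivAt (fun s => ρ.normed (volume : Measure (E d)) (x - s))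
        ((fderiv ℝ (ρ.normed (volume : Measure (E d))) (x - s)).comp
          (-ContinuousLinearMap.id ℝ (E d))) s :=
      ((hf.differentiable one_ne_zero).differentiableAt.hasFDerivAt).comp s
        ((hasFDerivAt_id s).const_sub x)
    have h2 : lineDeriv ℝ (fun s => ρ.normed (volume : Measure (E d)) (x - s)) s (-v) =
        fderiv ℝ (ρ.normed (volume : Measure (E d))) (x - s) v := by
      rw [(h1.hasLineDerivAt (-v)).lineDeriv]
      simp
    simp only [h2]
    rfl
  · refine integral_congr_ae (Eventually.of_forall fun s => ?_)
    simp [mul_comm]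

open scoped Convolution in
/-- The defining identity of a weak derivative extends to Lipschitz test functions. -/
lemma HasWeakPartial.integral_lineDeriv_eq {i : Fin d} {φ G : E d → ℂ}
    (h : HasWeakPartial U i φ G) {η : E d → ℝ} {C : ℝ≥0} (hη : LipschitzWith C η)
    (hc : HasCompactSupport η) (hs : tsupport η ⊆ U) :
    ∫ x in (U : Set (E d)), lineDeriv ℝ η x (EuclideanSpace.single i 1) • φ x =
      - ∫ x in (U : Set (E d)), η x • G x := by
  -- A closed δ-neighbourhood of the support is still compact in U and contains the supports of all
  -- mollifications with radius at most δ.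
  obtain ⟨δ, hδ, hδU⟩ := hc.isCompact.exists_cthickening_subset_open U.isOpen hs
  set K := Metric.cthickening δ (tsupport η) with hK
  have hKc : IsCompact K := hc.isCompact.cthickening
  set v : E d := EuclideanSpace.single i 1 with hv
  have hv1 : ‖v‖ = 1 := by simp [hv]
  -- The ratio of outer to inner radius is 2 for every n: the almost everywhere convergence of the
  -- mollified derivative, which is merely bounded and measurable, relies on Lebesgue
  -- differentiation and needs this ratio bounded.
  let ρ : ℕ → ContDiffBump (0 : E d) := fun n =>
    { rIn := δ / (2 * (n + 1)), rOut := δ / (n + 1), rIn_pos := by positivity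
      rIn_lt_rOut := by
        apply div_lt_div_of_pos_left hδ (by positivity)
        have : (0 : ℝ) ≤ n := n.cast_nonneg
        linarith }
  have hρout : ∀ n, (ρ n).rOut ≤ δ := fun n => by
    change δ / (n + 1) ≤ δ
    apply div_le_self hδ.le
    have : (0 : ℝ) ≤ n := n.cast_nonneg
    linarith
  have hρ0 : Tendsto (fun n => (ρ n).rOut) atTop (𝓝 0) := by
    have := tendsto_one_div_add_atTop_nhds_zero_nat (𝕜 := ℝ) |>.const_mul δ
    rw [mul_zero] at this
    refine this.congr fun n => ?_
    change δ * (1 / (n + 1)) = δ / (n + 1)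
    ring
  let ψ : ℕ → E d → ℝ := fun n =>
    (ρ n).normed volume ⋆[ContinuousLinearMap.lsmul ℝ ℝ, volume] η
  have hψd : ∀ n, ContDiff ℝ ((⊤ : ℕ∞) : WithTop ℕ∞) (ψ n) := fun n =>
    (ρ n).hasCompactSupport_normed.contDiff_convolution_left _ (ρ n).contDiff_normed
      hη.continuous.locallyIntegrable
  have hsuppK : ∀ n, Function.support (ψ n) ⊆ K := by
    intro n x hx
    obtain ⟨a, ha, b, hb, rfl⟩ := support_convolution_subset _ hx
    rw [(ρ n).support_normed_eq, Metric.mem_ball, dist_zero_right] at ha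
    refine Metric.mem_cthickening_of_dist_le _ b _ _ (subset_tsupport _ hb) ?_
    simpa using ha.le.trans (hρout n)
  have htsK : ∀ n, tsupport (ψ n) ⊆ K := fun n =>
    closure_minimal (hsuppK n) Metric.isClosed_cthickening
  have hψc : ∀ n, HasCompactSupport (ψ n) := fun n =>
    hKc.of_isClosed_subset (isClosed_tsupport _) (htsK n)
  have hψD : ∀ n x, fderiv ℝ (ψ n) x v = ((ρ n).normed volume ⋆[ContinuousLinearMap.lsmul ℝ ℝ,
      volume] fun y => lineDeriv ℝ η y v) x := fun n x =>
    fderiv_normed_convolution_apply (ρ n) hη hc x v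
  -- Mollification is averaging and preserves uniform bounds; this supplies the dominating functions
  -- below.
  have hbd : ∀ (w : E d → ℝ) (B : ℝ), AEStronglyMeasurable w volume → (∀ x, |w x| ≤ B) → ∀ n x,
      |((ρ n).normed volume ⋆[ContinuousLinearMap.lsmul ℝ ℝ, volume] w) x| ≤ B := by
    intro w B hw hB n x
    have := dist_convolution_le (μ := volume) (x₀ := x) (R := (ρ n).rOut) (ε := B) (z₀ := (0 : ℝ))
      (f := (ρ n).normed volume) (g := w) ((abs_nonneg _).trans (hB 0))
      (ρ n).support_normed_eq.subset (ρ n).nonneg_normed (ρ n).integral_normed hw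
      (fun y _ => by simpa using hB y)
    simpa using this
  have hφK : IntegrableOn φ K volume := h.locInt K hKc hδU
  have hGK : IntegrableOn G K volume := h.locInt_deriv K hKc hδU
  have hKm : MeasurableSet K := hKc.measurableSet
  have hφm : AEStronglyMeasurable (K.indicator φ) (volume.restrict (U : Set (E d))) :=
    (hφK.integrable_indicator hKm).aestronglyMeasurable.restrict
  have hGm : AEStronglyMeasurable (K.indicator G) (volume.restrict (U : Set (E d))) :=
    (hGK.integrable_indicator hKm).aestronglyMeasurable.restrict
  have hderK : ∀ n x, x ∉ K → fderiv ℝ (ψ n) x v = 0 := fun n x hx => by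
    have : fderiv ℝ (ψ n) x = 0 := by
      by_contra h0
      exact hx (htsK n (support_fderiv_subset ℝ h0))
    simp [this]
  obtain ⟨B, hB⟩ := hη.continuous.bounded_above_of_compact_support hc
  -- the two sides of the identity for the mollified test functions
  have h1 : Tendsto (fun n => ∫ x in (U : Set (E d)), fderiv ℝ (ψ n) x v • φ x) atTop
      (𝓝 (∫ x in (U : Set (E d)), lineDeriv ℝ η x v • φ x)) := by
    refine tendsto_integral_of_dominated_convergence (fun x => C * ‖K.indicator φ x‖) ?_ ?_ ?_ ?_
    · intro n
      have : (fun x => fderiv ℝ (ψ n) x v • φ x) = fun x => fderiv ℝ (ψ n) x v • K.indicator φ x := by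
        funext x
        by_cases hx : x ∈ K
        · simp [hx]
        · simp [hderK n x hx]
      rw [this]
      exact (((hψd n).continuous_fderiv (by simp)).clm_apply
        continuous_const).aestronglyMeasurable.smul hφm
    · exact ((hφK.integrable_indicator hKm).norm.const_mul _).restrict
    · intro n
      refine Eventually.of_forall fun x => ?_
      by_cases hx : x ∈ K
      · rw [norm_smul, indicator_of_mem hx]
        gcongr
        rw [hψD]
        refine hbd _ _ (aestronglyMeasurable_lineDeriv hη.continuous _) (fun y => ?_) n x
        simpa [hv1] using norm_lineDeriv_le_of_lipschitz ℝ hη (x₀ := y) (v := v)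
      · simp [hderK n x hx, hx]
    · have := ContDiffBump.ae_convolution_tendsto_right_of_locallyIntegrable (φ := ρ) (K := 2) hρ0
        (Eventually.of_forall fun n => le_of_eq (by
          change δ / (n + 1) = 2 * (δ / (2 * (n + 1)))
          field_simp)) (hη.locallyIntegrable_lineDeriv (μ := volume) v)
      filter_upwards [ae_restrict_of_ae this] with x hx
      simp only [hψD]
      exact hx.smul_const _
  have h2 : Tendsto (fun n => ∫ x in (U : Set (E d)), ψ n x • G x) atTop
      (𝓝 (∫ x in (U : Set (E d)), η x • G x)) := by
    refine tendsto_integral_of_dominated_convergence (fun x => B * ‖K.indicator G x‖) ?_ ?_ ?_ ?_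
    · intro n
      have : (fun x => ψ n x • G x) = fun x => ψ n x • K.indicator G x := by
        funext x
        by_cases hx : x ∈ K
        · simp [hx]
        · have : ψ n x = 0 := by
            by_contra h0
            exact hx (hsuppK n h0)
          simp [this]
      rw [this]
      exact (hψd n).continuous.aestronglyMeasurable.smul hGm
    · exact ((hGK.integrable_indicator hKm).norm.const_mul _).restrict
    · intro n
      refine Eventually.of_forall fun x => ?_
      by_cases hx : x ∈ K
      · rw [norm_smul, indicator_of_mem hx]
        gcongr
        exact hbd _ _ hη.continuous.aestronglyMeasurable (fun y => by simpa using hB y) n x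
      · have : ψ n x = 0 := by
          by_contra h0
          exact hx (hsuppK n h0)
        simp [this, hx]
    · refine Eventually.of_forall fun x => ?_
      exact (ContDiffBump.convolution_tendsto_right_of_continuous hρ0 hη.continuous x).smul_const _
  refine tendsto_nhds_unique h1 ?_
  refine (h2.neg).congr fun n => ?_
  exact (h.integral_eq (ψ n) (hψd n) (hψc n) ((htsK n).trans hδU)).symm

end WSob

/-! ### Functions that are Lipschitz on balls, and the product rule. -/

namespace WSob

variable {d : ℕ} {U : TopologicalSpace.Opens (E d)}

/-- Functions on `ℝ^d` that are Lipschitz on every ball. -/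
def LipschitzOnBalls {F : Type*} [PseudoEMetricSpace F] (h : E d → F) : Prop :=
  ∀ R : ℝ, ∃ C : ℝ≥0, LipschitzOnWith C h (Metric.ball 0 R)

namespace LipschitzOnBalls

lemma of_lipschitzWith {F : Type*} [PseudoEMetricSpace F] {h : E d → F} {C : ℝ≥0}
    (hh : LipschitzWith C h) : LipschitzOnBalls h := fun _ => ⟨C, hh.lipschitzOnWith⟩

lemma lipschitz_comp {F F' : Type*} [PseudoEMetricSpace F] [PseudoEMetricSpace F'] {h : E d → F}
    (hh : LipschitzOnBalls h) {f : F → F'} {C : ℝ≥0} (hf : LipschitzWith C f) :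
    LipschitzOnBalls fun x => f (h x) := fun R => by
  obtain ⟨D, hD⟩ := hh R
  exact ⟨C * D, hf.comp_lipschitzOnWith hD⟩

lemma continuous {F : Type*} [PseudoEMetricSpace F] {h : E d → F} (hh : LipschitzOnBalls h) :
    Continuous h := by
  rw [continuous_iff_continuousAt]
  intro x
  obtain ⟨C, hC⟩ := hh (‖x‖ + 1)
  exact hC.continuousOn.continuousAt (Metric.isOpen_ball.mem_nhds (by simp))

/-- Rademacher's theorem on the countably many balls of integer radius. -/
lemma ae_differentiableAt {F : Type*} [NormedAddCommGroup F] [NormedSpace ℝ F]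
    [FiniteDimensional ℝ F] {h : E d → F} (hh : LipschitzOnBalls h) :
    ∀ᵐ x, DifferentiableAt ℝ h x := by
  have : ∀ n : ℕ, ∀ᵐ x, x ∈ Metric.ball (0 : E d) n → DifferentiableAt ℝ h x := fun n => by
    obtain ⟨C, hC⟩ := hh n
    filter_upwards [hC.ae_differentiableWithinAt_of_mem (μ := volume)] with x hx hxn
    exact (hx hxn).differentiableAt (Metric.isOpen_ball.mem_nhds hxn)
  filter_upwards [ae_all_iff.2 this] with x hx
  obtain ⟨n, hn⟩ := exists_nat_gt ‖x‖
  exact hx n (by simpa using hn)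

lemma norm_lineDeriv_le {F : Type*} [NormedAddCommGroup F] [NormedSpace ℝ F]
    {h : E d → F} (hh : LipschitzOnBalls h) {K : Set (E d)} (hK : IsCompact K) (v : E d) :
    ∃ C : ℝ, ∀ x ∈ K, ‖lineDeriv ℝ h x v‖ ≤ C := by
  obtain ⟨R, hR⟩ := hK.isBounded.subset_ball (0 : E d)
  obtain ⟨C, hC⟩ := hh R
  exact ⟨C * ‖v‖, fun x hx =>
    norm_lineDeriv_le_of_lipschitzOn ℝ (Metric.isOpen_ball.mem_nhds (hR hx)) hC⟩

/-- A C¹ function such as an exponential is Lipschitz only on bounded intervals, and g maps balls to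
bounded sets. For this reason multipliers are asked to be Lipschitz on balls and not globally. -/
lemma comp_lipschitzWith {F : Type*} [NormedAddCommGroup F] [NormedSpace ℝ F] {u : ℝ → F}
    (hu : ContDiff ℝ 1 u) {g : E d → ℝ} {L : ℝ≥0} (hg : LipschitzWith L g) :
    LipschitzOnBalls fun x => u (g x) := by
  intro R
  obtain ⟨B, hB⟩ := ((isCompact_closedBall (0 : E d) R).image hg.continuous).isBounded.subset_closedBall 0
  obtain ⟨D, hD⟩ := (isCompact_closedBall (0 : ℝ) B).exists_bound_of_continuousOn
    (hu.continuous_deriv le_rfl).continuousOn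
  have h1 : LipschitzOnWith D.toNNReal u (Metric.closedBall 0 B) :=
    (convex_closedBall 0 B).lipschitzOnWith_of_nnnorm_deriv_le
      (fun x _ => (hu.differentiable one_ne_zero).differentiableAt)
      (fun x hx => by
        rw [← NNReal.coe_le_coe]
        exact (hD x hx).trans (Real.le_coe_toNNReal D))
  exact ⟨_, h1.comp (hg.lipschitzOnWith (s := Metric.ball 0 R)) fun x hx =>
    hB ⟨x, Metric.ball_subset_closedBall hx, rfl⟩⟩

/-- The product of a function that is Lipschitz on balls with a compactly supported Lipschitz
function is Lipschitz. -/
lemma exists_lipschitzWith_mul {𝕜 : Type*} [NormedRing 𝕜] {h φ : E d → 𝕜}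
    (hh : LipschitzOnBalls h) {C : ℝ≥0} (hφ : LipschitzWith C φ) (hc : HasCompactSupport φ) :
    ∃ D : ℝ≥0, LipschitzWith D fun x => h x * φ x := by
  obtain ⟨R, hR⟩ := hc.isCompact.isBounded.subset_ball (0 : E d)
  obtain ⟨D, hD⟩ := hh R
  obtain ⟨A, hA0, hA⟩ : ∃ A : ℝ, 0 ≤ A ∧ ∀ x ∈ tsupport φ, ‖h x‖ ≤ A := by
    obtain ⟨A, hA⟩ := hc.isCompact.exists_bound_of_continuousOn hh.continuous.continuousOn
    exact ⟨|A|, abs_nonneg A, fun x hx => (hA x hx).trans (le_abs_self A)⟩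
  obtain ⟨B, hB⟩ := hφ.continuous.bounded_above_of_compact_support hc
  have hB0 : 0 ≤ B := (norm_nonneg _).trans (hB 0)
  have hmem : ∀ x, φ x ≠ 0 → x ∈ tsupport φ := fun x hx => subset_tsupport _ hx
  -- Only x need lie in the support: if φ y = 0 the second term of the splitting vanishes, so y may
  -- lie outside the ball where h is controlled.
  have hasym : ∀ x y, φ x ≠ 0 →
      dist (h x * φ x) (h y * φ y) ≤ (A * C + D * B) * dist x y := by
    intro x y hx
    have e : h x * φ x - h y * φ y = h x * (φ x - φ y) + (h x - h y) * φ y := by noncomm_ring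
    have h1 : ‖h x * (φ x - φ y)‖ ≤ A * C * dist x y := by
      refine (norm_mul_le _ _).trans ?_
      rw [mul_assoc, ← dist_eq_norm]
      exact mul_le_mul (hA x (hmem x hx)) (hφ.dist_le_mul x y) dist_nonneg hA0
    have h2 : ‖(h x - h y) * φ y‖ ≤ D * B * dist x y := by
      by_cases hy : φ y = 0
      · simp only [hy, mul_zero, norm_zero]
        positivity
      · refine (norm_mul_le _ _).trans ?_
        rw [← dist_eq_norm, mul_right_comm]
        exact mul_le_mul (hD.dist_le_mul x (hR (hmem x hx)) y (hR (hmem y hy))) (hB y)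
          (norm_nonneg _) (by positivity)
    rw [dist_eq_norm, e, add_mul]
    exact (norm_add_le _ _).trans (add_le_add h1 h2)
  refine ⟨(A * C + D * B).toNNReal, LipschitzWith.of_dist_le_mul fun x y => ?_⟩
  refine le_trans ?_ (mul_le_mul_of_nonneg_right (Real.le_coe_toNNReal _) dist_nonneg)
  by_cases hx : φ x = 0
  · by_cases hy : φ y = 0
    · simp only [hx, hy, mul_zero, dist_self]
      positivity
    · rw [dist_comm, dist_comm x]
      exact hasym y x hy
  · exact hasym x y hx

end LipschitzOnBalls

/-- For a test function ψ the product hψ is Lipschitz with compact support in U, hence admissible in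
`integral_lineDeriv_eq`, and ∂(hψ) = h∂ψ + ψ∂h almost everywhere. The factor is real because test
functions are; the complex case follows by real and imaginary parts. -/
lemma HasWeakPartial.mul_real {i : Fin d} {φ G : E d → ℂ} (hφ : HasWeakPartial U i φ G)
    {h : E d → ℝ} (hh : LipschitzOnBalls h) :
    HasWeakPartial U i (fun x => (h x : ℂ) * φ x) (fun x => (h x : ℂ) * G x +
      ((lineDeriv ℝ h x (EuclideanSpace.single i 1) : ℝ) : ℂ) * φ x) := by
  set v : E d := EuclideanSpace.single i 1 with hv
  have hdm : Measurable fun x => lineDeriv ℝ h x v := measurable_lineDeriv hh.continuous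
  have hcont : Continuous fun x => (h x : ℂ) := Complex.continuous_ofReal.comp hh.continuous
  have hint : ∀ K : Set (E d), IsCompact K → K ⊆ U →
      IntegrableOn (fun x => ((lineDeriv ℝ h x v : ℝ) : ℂ) * φ x) K volume := by
    intro K hK hKU
    obtain ⟨C, hC⟩ := hh.norm_lineDeriv_le hK v
    refine Integrable.bdd_mul (c := C) (hφ.locInt K hK hKU)
      (Complex.measurable_ofReal.comp hdm).aestronglyMeasurable ?_
    filter_upwards [ae_restrict_mem hK.measurableSet] with x hx
    simpa using hC x hx
  refine ⟨fun K hK hKU => (hφ.locInt K hK hKU).continuousOn_mul hcont.continuousOn hK,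
    fun K hK hKU => ((hφ.locInt_deriv K hK hKU).continuousOn_mul hcont.continuousOn hK).add
      (hint K hK hKU), ?_⟩
  intro ψ hψ hψc hψU
  obtain ⟨Cψ, hCψ⟩ := (hψ.of_le (m := 1) (by exact_mod_cast le_top)).lipschitzWith_of_hasCompactSupport hψc one_ne_zero
  obtain ⟨D, hD⟩ := hh.exists_lipschitzWith_mul hCψ hψc
  have hsub : tsupport (fun x => h x * ψ x) ⊆ tsupport ψ := tsupport_mul_subset_right
  have key := hφ.integral_lineDeriv_eq hD (hψc.mono' ((subset_tsupport _).trans hsub))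
    (hsub.trans hψU)
  have hder : ∀ᵐ x ∂volume.restrict (U : Set (E d)), lineDeriv ℝ (fun x => h x * ψ x) x v =
      h x * fderiv ℝ ψ x v + ψ x * lineDeriv ℝ h x v := by
    filter_upwards [ae_restrict_of_ae hh.ae_differentiableAt] with x hx
    have hψx : DifferentiableAt ℝ ψ x := (hψ.differentiable (by simp)).differentiableAt
    have : HasFDerivAt (fun x => h x * ψ x) _ x := hx.hasFDerivAt.mul hψx.hasFDerivAt
    rw [(this.hasLineDerivAt v).lineDeriv, hx.lineDeriv_eq_fderiv]
    simp
  have hK : IsCompact (tsupport ψ) := hψc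
  have i1 : Integrable (fun x => (h x * fderiv ℝ ψ x v) • φ x) (volume.restrict (U : Set (E d))) := by
    refine integrable_smul_of_locInt hφ.locInt (hh.continuous.mul ((hψ.continuous_fderiv
      (by simp)).clm_apply continuous_const)) hK hψU ?_
    intro x hx
    apply support_fderiv_subset ℝ
    intro h0
    apply hx
    simp [h0]
  have i2 : Integrable (fun x => ψ x • (((lineDeriv ℝ h x v : ℝ) : ℂ) * φ x))
      (volume.restrict (U : Set (E d))) :=
    integrable_smul_of_locInt hint hψ.continuous hK hψU (subset_tsupport _)
  have i3 : Integrable (fun x => (h x * ψ x) • G x) (volume.restrict (U : Set (E d))) :=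
    integrable_smul_of_locInt hφ.locInt_deriv (hh.continuous.mul hψ.continuous) hK hψU
      ((subset_tsupport _).trans hsub)
  have e1 : ∫ x in (U : Set (E d)), lineDeriv ℝ (fun x => h x * ψ x) x v • φ x =
      (∫ x in (U : Set (E d)), (h x * fderiv ℝ ψ x v) • φ x) +
        ∫ x in (U : Set (E d)), ψ x • (((lineDeriv ℝ h x v : ℝ) : ℂ) * φ x) := by
    rw [← integral_add i1 i2]
    refine integral_congr_ae ?_
    filter_upwards [hder] with x hx
    rw [hx, add_smul]
    simp [Complex.real_smul, mul_assoc]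
  rw [e1] at key
  have e2 : ∫ x in (U : Set (E d)), fderiv ℝ ψ x v • ((h x : ℂ) * φ x) =
      ∫ x in (U : Set (E d)), (h x * fderiv ℝ ψ x v) • φ x := by
    refine integral_congr_ae (Eventually.of_forall fun x => ?_)
    simp only [Complex.real_smul]
    push_cast
    ring
  have e3 : ∫ x in (U : Set (E d)), ψ x • ((h x : ℂ) * G x + ((lineDeriv ℝ h x v : ℝ) : ℂ) * φ x) =
      (∫ x in (U : Set (E d)), (h x * ψ x) • G x) +
        ∫ x in (U : Set (E d)), ψ x • (((lineDeriv ℝ h x v : ℝ) : ℂ) * φ x) := by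
    rw [← integral_add i3 i2]
    refine integral_congr_ae (Eventually.of_forall fun x => ?_)
    simp only [Complex.real_smul]
    push_cast
    ring
  rw [e2, e3, eq_sub_of_add_eq key]
  ring

/-- The product rule for weak derivatives, with a factor that is Lipschitz on balls. -/
lemma HasWeakPartial.mul {i : Fin d} {φ G : E d → ℂ} (hφ : HasWeakPartial U i φ G)
    {h : E d → ℂ} (hh : LipschitzOnBalls h) :
    HasWeakPartial U i (fun x => h x * φ x) (fun x => h x * G x +
      lineDeriv ℝ h x (EuclideanSpace.single i 1) * φ x) := by
  have hre := hφ.mul_real (hh.lipschitz_comp (f := Complex.re) (C := 1)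
    (LipschitzWith.of_dist_le_mul fun a b => by
      simpa [dist_eq_norm, Complex.sub_re] using Complex.abs_re_le_norm (a - b)))
  have him := hφ.mul_real (hh.lipschitz_comp (f := Complex.im) (C := 1)
    (LipschitzWith.of_dist_le_mul fun a b => by
      simpa [dist_eq_norm, Complex.sub_im] using Complex.abs_im_le_norm (a - b)))
  refine (hre.add (him.const_smul Complex.I)).congr (Eventually.of_forall fun x => ?_) ?_
  · simp only [Pi.add_apply, Pi.smul_apply, smul_eq_mul]
    linear_combination φ x * Complex.re_add_im (h x)
  · filter_upwards [ae_restrict_of_ae hh.ae_differentiableAt] with x hx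
    have h1 := (Complex.reCLM.hasFDerivAt.comp x hx.hasFDerivAt).hasLineDerivAt
      (EuclideanSpace.single i 1)
    have h2 := (Complex.imCLM.hasFDerivAt.comp x hx.hasFDerivAt).hasLineDerivAt
      (EuclideanSpace.single i 1)
    have h1' : lineDeriv ℝ (fun x => (h x).re) x (EuclideanSpace.single i 1) =
      (fderiv ℝ h x (EuclideanSpace.single i 1)).re := h1.lineDeriv
    have h2' : lineDeriv ℝ (fun x => (h x).im) x (EuclideanSpace.single i 1) =
      (fderiv ℝ h x (EuclideanSpace.single i 1)).im := h2.lineDeriv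
    simp only [Pi.add_apply, Pi.smul_apply, smul_eq_mul]
    rw [h1', h2', hx.lineDeriv_eq_fderiv]
    linear_combination G x * Complex.re_add_im (h x) +
      φ x * Complex.re_add_im (fderiv ℝ h x (EuclideanSpace.single i 1))

/-- Weak derivatives are unique. -/
lemma HasWeakPartial.ae_eq_zero {i : Fin d} {φ G : E d → ℂ} (h : HasWeakPartial U i φ G)
    (h0 : φ =ᵐ[volume.restrict (U : Set (E d))] 0) :
    G =ᵐ[volume.restrict (U : Set (E d))] 0 := by
  have hloc : LocallyIntegrableOn G (U : Set (E d)) volume := by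
    rw [locallyIntegrableOn_iff U.isOpen.isLocallyClosed]
    exact fun K hKU hK => h.locInt_deriv K hK hKU
  have := U.isOpen.ae_eq_zero_of_integral_contDiff_smul_eq_zero hloc fun ψ hψ hψc hψU => by
    have h1 := h.integral_eq ψ hψ hψc hψU
    have h2 : ∫ x in (U : Set (E d)), fderiv ℝ ψ x (EuclideanSpace.single i 1) • φ x = 0 := by
      refine integral_eq_zero_of_ae ?_
      filter_upwards [h0] with x hx
      simp [hx]
    rw [h2, eq_comm, neg_eq_zero] at h1
    rw [← h1, setIntegral_eq_integral_of_forall_compl_eq_zero]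
    intro x hx
    have : ψ x = 0 := by
      by_contra h'
      exact hx (hψU (subset_tsupport _ h'))
    simp [this]
  exact (ae_restrict_iff' U.isOpen.measurableSet).2 this

end WSob

/-! ### Multipliers between weighted Sobolev spaces. -/

/-- Dominated convergence in `L^p`, for functions known up to null sets. -/
lemma Lp.tendsto_of_dominated {X ι : Type*} [MeasurableSpace X] {μ : Measure X} {p : ℝ≥0∞}
    [Fact (1 ≤ p)] (hp : p ≠ ∞) {l : Filter ι} [l.IsCountablyGenerated] {f : ι → Lp ℂ p μ}
    {f' : Lp ℂ p μ} {a : ι → X → ℂ} {a' : X → ℂ} {b : X → ℝ} (hb : MemLp b p μ)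
    (hf : ∀ᶠ t in l, f t =ᵐ[μ] a t) (hf' : f' =ᵐ[μ] a')
    (hab : ∀ᶠ t in l, ∀ᵐ x ∂μ, ‖a t x‖ ≤ b x) (hab' : ∀ᵐ x ∂μ, ‖a' x‖ ≤ b x)
    (hlim : ∀ᵐ x ∂μ, Tendsto (fun t => a t x) l (𝓝 (a' x))) : Tendsto f l (𝓝 f') := by
  have hp0 : p ≠ 0 := (zero_lt_one.trans_le (Fact.out : 1 ≤ p)).ne'
  have hpos : 0 < p.toReal := ENNReal.toReal_pos hp0 hp
  rw [Lp.tendsto_Lp_iff_tendsto_eLpNorm']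
  have key : Tendsto (fun t => ∫⁻ x, ‖a t x - a' x‖ₑ ^ p.toReal ∂μ) l (𝓝 (∫⁻ _, 0 ∂μ)) := by
    refine tendsto_lintegral_filter_of_dominated_convergence'
      (fun x => ‖(2 : ℝ) * b x‖ₑ ^ p.toReal) ?_ ?_ ?_ ?_
    · filter_upwards [hf] with t ht
      have h1 : AEStronglyMeasurable (a t) μ := (Lp.aestronglyMeasurable (f t)).congr ht
      have h2 : AEStronglyMeasurable a' μ := (Lp.aestronglyMeasurable f').congr hf'
      exact (h1.sub h2).enorm.pow_const _
    · filter_upwards [hab] with t ht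
      filter_upwards [ht, hab'] with x hx hx'
      gcongr
      rw [enorm_le_iff_norm_le]
      refine (norm_sub_le _ _).trans ((add_le_add hx hx').trans ?_)
      rw [← two_mul]
      exact le_abs_self _
    · have := (hb.const_mul 2).eLpNorm_lt_top
      exact (lintegral_rpow_enorm_lt_top_of_eLpNorm_lt_top hp0 hp this).ne
    · filter_upwards [hlim] with x hx
      have h1 : Tendsto (fun t => ‖a t x - a' x‖ₑ) l (𝓝 0) := by
        have := (hx.sub_const (a' x)).enorm
        simpa using this
      have := (ENNReal.continuous_rpow_const (y := p.toReal)).continuousAt.tendsto.comp h1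
      rwa [ENNReal.zero_rpow_of_pos hpos] at this
  rw [lintegral_zero] at key
  have key2 := (ENNReal.continuous_rpow_const (y := 1 / p.toReal)).continuousAt.tendsto.comp key
  simp only [ENNReal.zero_rpow_of_pos (one_div_pos.2 hpos)] at key2
  refine key2.congr' ?_
  filter_upwards [hf] with t ht
  rw [eLpNorm_congr_ae (ht.sub hf'), eLpNorm_eq_lintegral_rpow_enorm_toReal hp0 hp]
  rfl

namespace WSob

variable {d : ℕ} {U : TopologicalSpace.Opens (E d)} {p : ℝ≥0∞} [Fact (1 ≤ p)]
  {ω ω' : Weight U}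

lemma Weight.measure_eq_withDensity {G : E d → ℝ} (hG : Measurable G)
    (hω : ∀ x ∈ U, ω'.toFun x = ω.toFun x * Real.exp (G x)) :
    ω'.measure = ω.measure.withDensity fun x => ENNReal.ofReal (Real.exp (G x)) := by
  unfold Weight.measure
  rw [← withDensity_mul₀ ω.aemeasurable.ennreal_ofReal (by fun_prop)]
  refine withDensity_congr_ae ?_
  filter_upwards [ae_restrict_mem U.isOpen.measurableSet] with x hx
  rw [Pi.mul_apply, ← ENNReal.ofReal_mul (ω.pos x hx).le, hω x hx]

/-- The components `φ`, `∂₁ φ`, …, `∂_d φ` of an element `φ` of `W^{1,p}(U, ω)`. -/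
def Sobolev.comp (c : Fin (d + 1)) : Sobolev p ω →L[ℂ] Lp ℂ p ω.measure :=
  LinearMap.mkContinuous
    { toFun := fun F => F.1 c
      map_add' := fun _ _ => rfl
      map_smul' := fun _ _ => rfl } 1 fun F => by
    rw [one_mul]
    exact PiLp.norm_apply_le F.1 c

lemma Sobolev.norm_comp_le (c : Fin (d + 1)) (F : Sobolev p ω) : ‖Sobolev.comp c F‖ ≤ ‖F‖ :=
  PiLp.norm_apply_le F.1 c

lemma Sobolev.norm_le_of_comp (hp : p ≠ ∞) {F : Sobolev p ω} {M : ℝ} (hM : 0 ≤ M)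
    (h : ∀ c, ‖Sobolev.comp c F‖ ≤ M) : ‖F‖ ≤ (d + 1) * M := by
  have hp1 : 1 ≤ p.toReal := by
    have := ENNReal.toReal_mono hp (Fact.out : 1 ≤ p)
    simpa using this
  have hpos : 0 < p.toReal := zero_lt_one.trans_le hp1
  change ‖F.1‖ ≤ _
  rw [PiLp.norm_eq_sum hpos]
  have h1 : ∑ c, ‖F.1 c‖ ^ p.toReal ≤ ∑ _c : Fin (d + 1), M ^ p.toReal :=
    Finset.sum_le_sum fun c _ => Real.rpow_le_rpow (norm_nonneg _) (h c) hpos.le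
  refine (Real.rpow_le_rpow (Finset.sum_nonneg fun c _ => by positivity) h1
    (by positivity)).trans ?_
  simp only [Finset.sum_const, Finset.card_univ, Fintype.card_fin, nsmul_eq_mul]
  push_cast
  rw [Real.mul_rpow (by positivity) (by positivity), ← Real.rpow_mul hM,
    mul_one_div_cancel hpos.ne', Real.rpow_one]
  gcongr
  -- (d+1)^{1/p} ≤ d+1, as p ≥ 1.
  refine (Real.rpow_le_rpow_of_exponent_le (by linarith [(Nat.cast_nonneg d : (0 : ℝ) ≤ d)])
    (div_le_one_of_le₀ hp1 hpos.le)).trans_eq (Real.rpow_one _)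

lemma Sobolev.tendsto_of_comp {ι : Type*} {l : Filter ι} (hp : p ≠ ∞) {F : ι → Sobolev p ω}
    {F' : Sobolev p ω}
    (h : ∀ c, Tendsto (fun t => Sobolev.comp c (F t)) l (𝓝 (Sobolev.comp c F'))) :
    Tendsto F l (𝓝 F') := by
  rw [Metric.tendsto_nhds]
  intro ε hε
  have hd : (0 : ℝ) < d + 1 := by positivity
  have : ∀ᶠ t in l, ∀ c, dist (Sobolev.comp c (F t)) (Sobolev.comp c F') < ε / (2 * (d + 1)) :=
    eventually_all.2 fun c => Metric.tendsto_nhds.1 (h c) _ (by positivity)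
  filter_upwards [this] with t ht
  rw [dist_eq_norm]
  have := Sobolev.norm_le_of_comp hp (F := F t - F') (M := ε / (2 * (d + 1))) (by positivity)
    fun c => by
      rw [map_sub, ← dist_eq_norm]
      exact (ht c).le
  refine this.trans_lt ?_
  have : ((d : ℝ) + 1) * (ε / (2 * (d + 1))) = ε / 2 := by field_simp
  linarith

lemma sobolevIncl_ae (F : Sobolev p ω) :
    sobolevIncl p ω F =ᵐ[volume.restrict (U : Set (E d))] Sobolev.comp 0 F :=
  AEEqFun.coeFn_mk _ _

lemma Sobolev.hasWeakPartial (F : Sobolev p ω) (i : Fin d) :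
    HasWeakPartial U i (Sobolev.comp 0 F) (Sobolev.comp i.succ F) := F.2 i

/-- Two functions with locally integrable gradients agree as soon as they agree almost
everywhere. -/
lemma Sobolev.ext_of_ae {F F' : Sobolev p ω}
    (h : Sobolev.comp 0 F =ᵐ[volume.restrict (U : Set (E d))] Sobolev.comp 0 F') : F = F' := by
  rw [← sub_eq_zero]
  have h0 : Sobolev.comp 0 (F - F') =ᵐ[volume.restrict (U : Set (E d))] (0 : E d → ℂ) := by
    rw [map_sub]
    filter_upwards [h, ω.ac_measure.ae_eq (Lp.coeFn_sub (Sobolev.comp 0 F) (Sobolev.comp 0 F'))]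
      with x hx hx'
    rw [hx', Pi.sub_apply, hx, sub_self, Pi.zero_apply]
  have h1 : ∀ c, Sobolev.comp c (F - F') = 0 := by
    intro c
    rw [Lp.eq_zero_iff_ae_eq_zero]
    refine Fin.cases ?_ (fun i => ?_) c
    · exact ω.measure_ac.ae_eq h0
    · exact ω.measure_ac.ae_eq (((F - F').hasWeakPartial i).ae_eq_zero h0)
  apply Subtype.ext
  ext1 c
  exact h1 c

lemma sobolevIncl_injective : Function.Injective (sobolevIncl p ω) := by
  intro F F' h
  refine Sobolev.ext_of_ae ((sobolevIncl_ae F).symm.trans ?_)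
  rw [h]
  exact sobolevIncl_ae F'

/-- Constructs an element of `W^{1,p}(U, ω)` from its components. -/
lemma Sobolev.exists_of_memLp (φ : Fin (d + 1) → E d → ℂ) (hφ : ∀ c, MemLp (φ c) p ω.measure)
    (h : ∀ i : Fin d, HasWeakPartial U i (φ 0) (φ i.succ)) :
    ∃ F : Sobolev p ω, ∀ c, Sobolev.comp c F =ᵐ[volume.restrict (U : Set (E d))] φ c := by
  have hae : ∀ c, (hφ c).toLp (φ c) =ᵐ[volume.restrict (U : Set (E d))] φ c := fun c =>
    ω.ac_measure.ae_eq (hφ c).coeFn_toLp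
  refine ⟨⟨WithLp.toLp p fun c => (hφ c).toLp (φ c), fun i => ?_⟩, hae⟩
  exact (h i).congr (hae 0).symm (hae i.succ).symm

/-- `F'` is the product of `F` with `h`, where `k` is the gradient of `h`. -/
def IsMul (h : E d → ℂ) (k : Fin d → E d → ℂ) (F : Sobolev p ω) (F' : Sobolev p ω') : Prop :=
  (Sobolev.comp 0 F' =ᵐ[volume.restrict (U : Set (E d))] fun x => h x * Sobolev.comp 0 F x) ∧
  ∀ i : Fin d, Sobolev.comp i.succ F' =ᵐ[volume.restrict (U : Set (E d))] fun x =>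
    h x * Sobolev.comp i.succ F x + k i x * Sobolev.comp 0 F x

/-- `h` is bounded, relative to the change of weight from `ω` to `ω' = ω e^G`, by `C`. -/
def MulBound (U : TopologicalSpace.Opens (E d)) (p : ℝ≥0∞) (G : E d → ℝ) (C : ℝ)
    (h : E d → ℂ) : Prop :=
  ∀ᵐ x ∂volume.restrict (U : Set (E d)), ‖h x‖ * Real.exp (G x / p.toReal) ≤ C

lemma comp_sub_ae (c : Fin (d + 1)) (F F' : Sobolev p ω) :
    Sobolev.comp c (F - F') =ᵐ[volume.restrict (U : Set (E d))]
      fun x => Sobolev.comp c F x - Sobolev.comp c F' x := by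
  rw [map_sub]
  exact ω.ac_measure.ae_eq (Lp.coeFn_sub _ _)

lemma comp_smul_ae (c : Fin (d + 1)) (a : ℂ) (F : Sobolev p ω) :
    Sobolev.comp c (a • F) =ᵐ[volume.restrict (U : Set (E d))]
      fun x => a * Sobolev.comp c F x := by
  rw [map_smul]
  exact ω.ac_measure.ae_eq (Lp.coeFn_smul _ _)

namespace IsMul

variable {h h₁ h₂ : E d → ℂ} {k k₁ k₂ : Fin d → E d → ℂ} {F F₁ F₂ : Sobolev p ω}
  {F' F₁' F₂' : Sobolev p ω'}

lemma sub_left (H₁ : IsMul h₁ k₁ F F₁') (H₂ : IsMul h₂ k₂ F F₂') :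
    IsMul (fun x => h₁ x - h₂ x) (fun i x => k₁ i x - k₂ i x) F (F₁' - F₂') := by
  refine ⟨?_, fun i => ?_⟩
  · filter_upwards [comp_sub_ae 0 F₁' F₂', H₁.1, H₂.1] with x e1 e2 e3
    rw [e1, e2, e3]
    ring
  · filter_upwards [comp_sub_ae i.succ F₁' F₂', H₁.2 i, H₂.2 i] with x e1 e2 e3
    rw [e1, e2, e3]
    ring

lemma smul_left (a : ℂ) (H : IsMul h k F F') :
    IsMul (fun x => a * h x) (fun i x => a * k i x) F (a • F') := by
  refine ⟨?_, fun i => ?_⟩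
  · filter_upwards [comp_smul_ae 0 a F', H.1] with x e1 e2
    rw [e1, e2]
    ring
  · filter_upwards [comp_smul_ae i.succ a F', H.2 i] with x e1 e2
    rw [e1, e2]
    ring

lemma sub_right (H₁ : IsMul h k F₁ F₁') (H₂ : IsMul h k F₂ F₂') :
    IsMul h k (F₁ - F₂) (F₁' - F₂') := by
  refine ⟨?_, fun i => ?_⟩
  · filter_upwards [comp_sub_ae 0 F₁' F₂', comp_sub_ae 0 F₁ F₂, H₁.1, H₂.1] with x e1 e2 e3 e4
    rw [e1, e2, e3, e4]
    ring
  · filter_upwards [comp_sub_ae i.succ F₁' F₂', comp_sub_ae i.succ F₁ F₂, comp_sub_ae 0 F₁ F₂,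
      H₁.2 i, H₂.2 i] with x e1 e2 e3 e4 e5
    rw [e1, e2, e3, e4, e5]
    ring

end IsMul

section Bounds

variable {G : E d → ℝ} {h : E d → ℂ} {k : Fin d → E d → ℂ} {C : ℝ}

/-- The norm of hφ for the weight ωe^G is that of e^{G/p}hφ for ω, and `MulBound` is the bound on
e^{G/p}|h|. -/
lemma MulBound.eLpNorm_mul_le (hp : p ≠ ∞) (hG : Measurable G)
    (hω : ∀ x ∈ U, ω'.toFun x = ω.toFun x * Real.exp (G x))
    (hh : AEStronglyMeasurable h (volume.restrict (U : Set (E d)))) (hC : MulBound U p G C h)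
    (φ : Lp ℂ p ω.measure) :
    MemLp (fun x => h x * φ x) p ω'.measure ∧
      eLpNorm (fun x => h x * φ x) p ω'.measure ≤ ENNReal.ofReal C * eLpNorm φ p ω.measure := by
  have hp0 : p ≠ 0 := (zero_lt_one.trans_le (Fact.out : 1 ≤ p)).ne'
  have hm : AEStronglyMeasurable (fun x => h x * φ x) ω.measure :=
    (hh.mono_ac ω.measure_ac).mul (Lp.aestronglyMeasurable φ)
  have hle : eLpNorm (fun x => h x * φ x) p ω'.measure ≤
      ENNReal.ofReal C * eLpNorm φ p ω.measure := by
    rw [Weight.measure_eq_withDensity hG hω, eLpNorm_withDensity_exp hp0 hp hG.aemeasurable hm]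
    refine eLpNorm_le_mul_eLpNorm_of_ae_le_mul ?_ p
    filter_upwards [ω.measure_ac.ae_le hC] with x hx
    rw [norm_smul, Real.norm_of_nonneg (Real.exp_pos _).le, norm_mul, ← mul_assoc,
      mul_comm (Real.exp _)]
    exact mul_le_mul_of_nonneg_right hx (norm_nonneg _)
  refine ⟨⟨?_, hle.trans_lt (ENNReal.mul_lt_top ENNReal.ofReal_lt_top (Lp.eLpNorm_lt_top φ))⟩, hle⟩
  exact (hh.mono_ac ω'.measure_ac).mul
    ((Lp.aestronglyMeasurable φ).mono_ac (ω'.measure_ac.trans ω.ac_measure))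

/-- Multiplication by a function that is Lipschitz on balls maps `W^{1,p}(U, ω)` to
`W^{1,p}(U, ω')`, if the function and its gradient are bounded relative to the weights. -/
lemma exists_isMul (hp : p ≠ ∞) (hG : Measurable G)
    (hω : ∀ x ∈ U, ω'.toFun x = ω.toFun x * Real.exp (G x)) (hh : LipschitzOnBalls h)
    (hk : ∀ i, k i =ᵐ[volume.restrict (U : Set (E d))]
      fun x => lineDeriv ℝ h x (EuclideanSpace.single i 1))
    (hC : MulBound U p G C h) (hCk : ∀ i, MulBound U p G C (k i)) (F : Sobolev p ω) :
    ∃ F' : Sobolev p ω', IsMul h k F F' := by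
  have hhm : AEStronglyMeasurable h (volume.restrict (U : Set (E d))) :=
    hh.continuous.aestronglyMeasurable
  have hkm : ∀ i, AEStronglyMeasurable (k i) (volume.restrict (U : Set (E d))) := fun i =>
    (aestronglyMeasurable_lineDeriv hh.continuous _).congr (hk i).symm
  obtain ⟨F', hF'⟩ := Sobolev.exists_of_memLp (p := p) (ω := ω')
    (Fin.cons (fun x => h x * Sobolev.comp 0 F x) fun i x =>
      h x * Sobolev.comp i.succ F x + k i x * Sobolev.comp 0 F x)
    (by
      refine Fin.cases ?_ fun i => ?_
      · exact (hC.eLpNorm_mul_le hp hG hω hhm _).1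
      · exact (hC.eLpNorm_mul_le hp hG hω hhm _).1.add
          ((hCk i).eLpNorm_mul_le hp hG hω (hkm i) _).1)
    (by
      intro i
      refine ((F.hasWeakPartial i).mul hh).congr EventuallyEq.rfl ?_
      filter_upwards [hk i] with x hx
      simp only [Fin.cons_succ]
      rw [hx])
  exact ⟨F', hF' 0, fun i => hF' i.succ⟩

/-- Each partial derivative of a product has two terms, whence 2C; the factor d+1 comes from
`Sobolev.norm_le_of_comp`. -/
lemma IsMul.norm_le (hp : p ≠ ∞) (hG : Measurable G)
    (hω : ∀ x ∈ U, ω'.toFun x = ω.toFun x * Real.exp (G x))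
    (hhm : AEStronglyMeasurable h (volume.restrict (U : Set (E d))))
    (hkm : ∀ i, AEStronglyMeasurable (k i) (volume.restrict (U : Set (E d))))
    (hC0 : 0 ≤ C)
    (hC : MulBound U p G C h) (hCk : ∀ i, MulBound U p G C (k i)) {F : Sobolev p ω}
    {F' : Sobolev p ω'} (H : IsMul h k F F') : ‖F'‖ ≤ (d + 1) * (2 * C * ‖F‖) := by
  have hle : ∀ (c : Fin (d + 1)) (h : E d → ℂ),
      AEStronglyMeasurable h (volume.restrict (U : Set (E d))) → MulBound U p G C h →
      eLpNorm (fun x => h x * Sobolev.comp c F x) p ω'.measure ≤ ENNReal.ofReal (C * ‖F‖) := by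
    intro c h hm hC
    refine (hC.eLpNorm_mul_le hp hG hω hm (Sobolev.comp c F)).2.trans ?_
    rw [ENNReal.ofReal_mul hC0]
    gcongr
    rw [ENNReal.le_ofReal_iff_toReal_le (Lp.eLpNorm_ne_top _) (norm_nonneg _)]
    exact Sobolev.norm_comp_le c F
  refine Sobolev.norm_le_of_comp hp (by positivity) fun c => ?_
  rw [Lp.norm_def]
  refine ENNReal.toReal_le_of_le_ofReal (by positivity) ?_
  have h2 : ENNReal.ofReal (2 * C * ‖F‖) =
      ENNReal.ofReal (C * ‖F‖) + ENNReal.ofReal (C * ‖F‖) := by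
    rw [← ENNReal.ofReal_add (by positivity) (by positivity)]
    ring_nf
  rw [h2]
  refine Fin.cases ?_ (fun i => ?_) c
  · rw [eLpNorm_congr_ae (ω'.measure_ac.ae_eq H.1)]
    exact (hle 0 h hhm hC).trans le_self_add
  · rw [eLpNorm_congr_ae (ω'.measure_ac.ae_eq (H.2 i))]
    have hm : ∀ (c : Fin (d + 1)) (h : E d → ℂ),
        AEStronglyMeasurable h (volume.restrict (U : Set (E d))) →
        AEStronglyMeasurable (fun x => h x * Sobolev.comp c F x) ω'.measure := fun c h hh =>
      (hh.mono_ac ω'.measure_ac).mul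
        ((Lp.aestronglyMeasurable (Sobolev.comp c F)).mono_ac (ω'.measure_ac.trans ω.ac_measure))
    exact (eLpNorm_add_le (hm _ _ hhm) (hm _ _ (hkm i)) Fact.out).trans
      (add_le_add (hle _ h hhm hC) (hle _ (k i) (hkm i) (hCk i)))

/-- Dominated convergence for multipliers. -/
lemma IsMul.tendsto (hp : p ≠ ∞) (hG : Measurable G)
    (hω : ∀ x ∈ U, ω'.toFun x = ω.toFun x * Real.exp (G x)) {ι : Type*} {l : Filter ι}
    [l.IsCountablyGenerated] {H : ι → E d → ℂ} {K : ι → Fin d → E d → ℂ}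
    (hC : ∀ᶠ t in l, MulBound U p G C (H t)) (hCk : ∀ᶠ t in l, ∀ i, MulBound U p G C (K t i))
    (hC' : MulBound U p G C h) (hCk' : ∀ i, MulBound U p G C (k i))
    (hH : ∀ᵐ x ∂volume.restrict (U : Set (E d)), Tendsto (fun t => H t x) l (𝓝 (h x)))
    (hK : ∀ i, ∀ᵐ x ∂volume.restrict (U : Set (E d)), Tendsto (fun t => K t i x) l (𝓝 (k i x)))
    {F : Sobolev p ω} {F' : ι → Sobolev p ω'} {F₀ : Sobolev p ω'}
    (hF' : ∀ᶠ t in l, IsMul (H t) (K t) F (F' t)) (hF₀ : IsMul h k F F₀) :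
    Tendsto F' l (𝓝 F₀) := by
  have hp0 : p ≠ 0 := (zero_lt_one.trans_le (Fact.out : 1 ≤ p)).ne'
  -- the dominating function
  let e : E d → ℂ := fun x => ((C * Real.exp (-(G x / p.toReal)) : ℝ) : ℂ)
  have hem : AEStronglyMeasurable e (volume.restrict (U : Set (E d))) := by
    apply Measurable.aestronglyMeasurable
    fun_prop
  have heC : MulBound U p G |C| e := Eventually.of_forall fun x => by
    rw [Complex.norm_real, norm_mul, Real.norm_of_nonneg (Real.exp_pos _).le, mul_assoc,
      ← Real.exp_add, neg_add_cancel, Real.exp_zero, mul_one, Real.norm_eq_abs]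
  have hbd : ∀ {f : E d → ℂ}, MulBound U p G C f → ∀ c, ∀ᵐ x ∂ω'.measure,
      ‖f x * Sobolev.comp c F x‖ ≤ ‖e x * Sobolev.comp c F x‖ := by
    intro f hf c
    filter_upwards [ω'.measure_ac.ae_le hf] with x hx
    rw [norm_mul, norm_mul]
    gcongr
    rw [Complex.norm_real, norm_mul, Real.norm_of_nonneg (Real.exp_pos _).le, Real.exp_neg,
      ← div_eq_mul_inv, le_div_iff₀ (Real.exp_pos _)]
    exact hx.trans (le_abs_self C)
  have hme : ∀ c, MemLp (fun x => ‖e x * Sobolev.comp c F x‖) p ω'.measure := fun c =>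
    (heC.eLpNorm_mul_le hp hG hω hem _).1.norm
  refine Sobolev.tendsto_of_comp hp fun c => ?_
  refine Fin.cases ?_ (fun i => ?_) c
  · refine Lp.tendsto_of_dominated hp (hme 0)
      (a := fun t x => H t x * Sobolev.comp 0 F x) ?_ (ω'.measure_ac.ae_eq hF₀.1) ?_
      (hbd hC' 0) ?_
    · filter_upwards [hF'] with t ht using ω'.measure_ac.ae_eq ht.1
    · filter_upwards [hC] with t ht using hbd ht 0
    · filter_upwards [ω'.measure_ac.ae_le hH] with x hx using hx.mul_const _
  · have hbd2 : ∀ {f g : E d → ℂ}, MulBound U p G C f → MulBound U p G C g → ∀ᵐ x ∂ω'.measure,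
        ‖f x * Sobolev.comp i.succ F x + g x * Sobolev.comp 0 F x‖ ≤
          ‖e x * Sobolev.comp i.succ F x‖ + ‖e x * Sobolev.comp 0 F x‖ := by
      intro f g hf hg
      filter_upwards [hbd hf i.succ, hbd hg 0] with x h1 h2
      exact (norm_add_le _ _).trans (add_le_add h1 h2)
    refine Lp.tendsto_of_dominated hp ((hme i.succ).add (hme 0))
      (a := fun t x => H t x * Sobolev.comp i.succ F x + K t i x * Sobolev.comp 0 F x) ?_
      (ω'.measure_ac.ae_eq (hF₀.2 i)) ?_ (hbd2 hC' (hCk' i)) ?_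
    · filter_upwards [hF'] with t ht using ω'.measure_ac.ae_eq (ht.2 i)
    · filter_upwards [hC, hCk] with t ht ht' using hbd2 ht (ht' i)
    · filter_upwards [ω'.measure_ac.ae_le hH, ω'.measure_ac.ae_le (hK i)] with x hx hx'
      exact (hx.mul_const _).add (hx'.mul_const _)

/-- Multiplication by a function that is Lipschitz on balls preserves the closure of `Lip_c`. -/
lemma IsMul.mem_sobolevZero (hp : p ≠ ∞) (hG : Measurable G)
    (hω : ∀ x ∈ U, ω'.toFun x = ω.toFun x * Real.exp (G x)) (hh : LipschitzOnBalls h)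
    (hk : ∀ i, k i =ᵐ[volume.restrict (U : Set (E d))]
      fun x => lineDeriv ℝ h x (EuclideanSpace.single i 1)) (hC0 : 0 ≤ C)
    (hC : MulBound U p G C h) (hCk : ∀ i, MulBound U p G C (k i)) {F : Sobolev p ω}
    {F' : Sobolev p ω'} (H : IsMul h k F F') (hF : F ∈ sobolevZero p ω) :
    F' ∈ sobolevZero p ω' := by
  have hhm : AEStronglyMeasurable h (volume.restrict (U : Set (E d))) :=
    hh.continuous.aestronglyMeasurable
  have hkm : ∀ i, AEStronglyMeasurable (k i) (volume.restrict (U : Set (E d))) := fun i =>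
    (aestronglyMeasurable_lineDeriv hh.continuous _).congr (hk i).symm
  -- The products of h with Lip_c approximants of F are again in Lip_c, and `norm_le` carries the
  -- convergence over.
  obtain ⟨l, hl, hlim⟩ := mem_closure_iff_seq_limit.1 hF
  choose l' hl' using fun n => exists_isMul hp hG hω hh hk hC hCk (l n)
  refine mem_closure_iff_seq_limit.2 ⟨l', fun n => ?_, ?_⟩
  · obtain ⟨φ, ⟨D, hD⟩, hc, hs, hv⟩ := hl n
    obtain ⟨D', hD'⟩ := hh.exists_lipschitzWith_mul hD hc
    have hsub : tsupport (fun x => h x * φ x) ⊆ tsupport φ := tsupport_mul_subset_right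
    refine ⟨fun x => h x * φ x, ⟨D', hD'⟩, hc.mono' ((subset_tsupport _).trans hsub),
      hsub.trans hs, ?_⟩
    refine (sobolevIncl_ae (l' n)).trans ((hl' n).1.trans ?_)
    filter_upwards [hv, sobolevIncl_ae (l n)] with x e1 e2
    rw [← e2, e1]
  · rw [tendsto_iff_norm_sub_tendsto_zero] at hlim ⊢
    have := (hlim.const_mul (2 * C)).const_mul ((d : ℝ) + 1)
    simp only [mul_zero] at this
    exact squeeze_zero (fun _ => norm_nonneg _) (fun n =>
      ((hl' n).sub_right H).norm_le hp hG hω hhm hkm hC0 hC hCk) this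

end Bounds

end WSob

/-! ### Analytic families of multipliers. -/

namespace WSob

variable {d : ℕ} {U : TopologicalSpace.Opens (E d)} {p : ℝ≥0∞} [Fact (1 ≤ p)]
  {ω ω' : Weight U} {g : E d → ℝ} {L : ℝ≥0} {κ : ℝ}

/-- The gradient of `u ∘ g`, where `u'` is the derivative of `u`. -/
def compGrad (g : E d → ℝ) (u' : ℝ → ℂ) (i : Fin d) (x : E d) : ℂ :=
  u' (g x) * ((lineDeriv ℝ g x (EuclideanSpace.single i 1) : ℝ) : ℂ)

lemma compGrad_ae_eq (hg : LipschitzWith L g) {u u' : ℝ → ℂ} (hu : ∀ t, HasDerivAt u (u' t) t)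
    (i : Fin d) : compGrad g u' i =ᵐ[volume.restrict (U : Set (E d))]
      fun x => lineDeriv ℝ (fun x => u (g x)) x (EuclideanSpace.single i 1) := by
  filter_upwards [ae_restrict_of_ae hg.ae_differentiableAt] with x hx
  have h1 : HasFDerivAt (fun x => u (g x)) _ x := (hu (g x)).hasFDerivAt.comp x hx.hasFDerivAt
  rw [(h1.hasLineDerivAt _).lineDeriv, compGrad, hx.lineDeriv_eq_fderiv]
  simp [mul_comm]

lemma compGrad_aestronglyMeasurable (hg : LipschitzWith L g) {u' : ℝ → ℂ} (hu' : Continuous u')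
    (i : Fin d) : AEStronglyMeasurable (compGrad g u' i) (volume.restrict (U : Set (E d))) :=
  (hu'.comp hg.continuous).aestronglyMeasurable.mul
    (Complex.measurable_ofReal.comp (measurable_lineDeriv hg.continuous)).aestronglyMeasurable

lemma contDiff_one_of_hasDerivAt {u u' : ℝ → ℂ} (hu : ∀ t, HasDerivAt u (u' t) t)
    (hu' : Continuous u') : ContDiff ℝ 1 u := by
  rw [contDiff_one_iff_deriv]
  refine ⟨fun t => (hu t).differentiableAt, ?_⟩
  rwa [show deriv u = u' from funext fun t => (hu t).deriv]

omit [Fact (1 ≤ p)] in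
-- The factor L+1 lets one constant serve both u∘g and its gradient, which involves |∇g| ≤ L.
lemma mulBound_comp {u : ℝ → ℂ} {B : ℝ} (hu : ∀ t, ‖u t‖ * Real.exp (κ * t / p.toReal) ≤ B) :
    MulBound U p (fun x => κ * g x) (B * (L + 1)) fun x => u (g x) :=
  Eventually.of_forall fun x => by
    have hB : 0 ≤ B := le_trans (by positivity) (hu 0)
    refine (hu (g x)).trans (le_mul_of_one_le_right hB ?_)
    simp

omit [Fact (1 ≤ p)] in
lemma mulBound_compGrad (hg : LipschitzWith L g) {u : ℝ → ℂ} {B : ℝ}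
    (hu : ∀ t, ‖u t‖ * Real.exp (κ * t / p.toReal) ≤ B) (i : Fin d) :
    MulBound U p (fun x => κ * g x) (B * (L + 1)) (compGrad g u i) :=
  Eventually.of_forall fun x => by
    have hB : 0 ≤ B := le_trans (by positivity) (hu 0)
    rw [compGrad, norm_mul, mul_right_comm, Complex.norm_real]
    refine mul_le_mul (hu (g x)) ?_ (norm_nonneg _) hB
    have := norm_lineDeriv_le_of_lipschitz ℝ hg (x₀ := x)
      (v := EuclideanSpace.single i (1 : ℝ))
    simp only [PiLp.norm_single, norm_one, mul_one] at this
    linarith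

/-- The set `T` contains all products of `F` with functions for which multiplication is a bounded
operation from `W^{1,p}(U, ω)` to `W^{1,p}(U, ω e^G)`. -/
def MulStable (G : E d → ℝ) (F : Sobolev p ω) (T : Set (Sobolev p ω')) : Prop :=
  ∀ (h : E d → ℂ) (k : Fin d → E d → ℂ) (C : ℝ) (F' : Sobolev p ω'), LipschitzOnBalls h →
    (∀ i, k i =ᵐ[volume.restrict (U : Set (E d))]
      fun x => lineDeriv ℝ h x (EuclideanSpace.single i 1)) → 0 ≤ C →
    MulBound U p G C h → (∀ i, MulBound U p G C (k i)) → IsMul h k F F' → F' ∈ T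

/-- An analytic family of functions of `g`, with bounds that match the change of weight, gives an
analytic family of multiples of an element of `W^{1,p}(U, ω)`. -/
lemma exists_mulFamily (hp : p ≠ ∞) (hg : LipschitzWith L g)
    (hω : ∀ x ∈ U, ω'.toFun x = ω.toFun x * Real.exp (κ * g x)) {S : Set ℂ}
    {V V' D D' : ℂ → ℝ → ℂ} {B : ℝ} (hB0 : 0 ≤ B)
    (hV : ∀ z t, HasDerivAt (V z) (V' z t) t) (hV'c : ∀ z, Continuous (V' z))
    (hD : ∀ z t, HasDerivAt (D z) (D' z t) t) (hD'c : ∀ z, Continuous (D' z))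
    (hVz : ∀ z t, HasDerivAt (fun w => V w t) (D z t) z)
    (hV'z : ∀ z t, HasDerivAt (fun w => V' w t) (D' z t) z)
    (hB : ∀ z ∈ S, ∀ t, ‖V z t‖ * Real.exp (κ * t / p.toReal) ≤ B)
    (hB' : ∀ z ∈ S, ∀ t, ‖V' z t‖ * Real.exp (κ * t / p.toReal) ≤ B)
    {A : Type*} [NormedAddCommGroup A] [NormedSpace ℂ A] (j : A →ₗᵢ[ℂ] Sobolev p ω')
    (F : Sobolev p ω) (hj : MulStable (fun x => κ * g x) F (Set.range j)) :
    ∃ Φ : ℂ → A, (∀ z ∈ S, IsMul (fun x => V z (g x)) (compGrad g (V' z)) F (j (Φ z))) ∧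
      ContinuousOn Φ S ∧ DifferentiableOn ℂ Φ (interior S) ∧
      ∀ z ∈ S, ‖Φ z‖ ≤ (d + 1) * (2 * (B * (L + 1)) * ‖F‖) := by
  have hG : Measurable fun x => κ * g x := hg.continuous.measurable.const_mul κ
  have hex : ∀ {u u' : ℝ → ℂ} {B : ℝ}, (∀ t, HasDerivAt u (u' t) t) → Continuous u' →
      (∀ t, ‖u t‖ * Real.exp (κ * t / p.toReal) ≤ B) →
      (∀ t, ‖u' t‖ * Real.exp (κ * t / p.toReal) ≤ B) →
      ∃ a : A, IsMul (fun x => u (g x)) (compGrad g u') F (j a) := by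
    intro u u' B hu hu' hb hb'
    have hB : 0 ≤ B := le_trans (by positivity) (hb 0)
    have hl : LipschitzOnBalls fun x => u (g x) :=
      LipschitzOnBalls.comp_lipschitzWith (contDiff_one_of_hasDerivAt hu hu') hg
    have hk := fun i => compGrad_ae_eq (U := U) hg hu i
    have hb1 := mulBound_comp (U := U) (g := g) (L := L) hb
    have hb2 := fun i => mulBound_compGrad (U := U) hg hb' i
    obtain ⟨F', hF'⟩ := exists_isMul hp hG hω hl hk hb1 hb2 F
    obtain ⟨a, rfl⟩ := hj _ _ _ F' hl hk (by positivity) hb1 hb2 hF'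
    exact ⟨a, hF'⟩
  have hex' : ∀ z, ∃ a : A, z ∈ S →
      IsMul (fun x => V z (g x)) (compGrad g (V' z)) F (j a) := by
    intro z
    by_cases hz : z ∈ S
    · obtain ⟨a, ha⟩ := hex (hV z) (hV'c z) (hB z hz) (hB' z hz)
      exact ⟨a, fun _ => ha⟩
    · exact ⟨0, fun h => absurd h hz⟩
  choose Φ hΦ using hex'
  refine ⟨Φ, hΦ, ?_, ?_, ?_⟩
  · intro z hz
    refine (j.isometry.isEmbedding.isInducing.tendsto_nhds_iff).2 ?_
    refine IsMul.tendsto (C := B * (L + 1)) hp hG hω (H := fun w x => V w (g x))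
      (K := fun w => compGrad g (V' w)) ?_ ?_ (mulBound_comp (hB z hz))
      (fun i => mulBound_compGrad hg (hB' z hz) i) ?_ ?_ ?_ (hΦ z hz)
    · filter_upwards [self_mem_nhdsWithin] with w hw using mulBound_comp (hB w hw)
    · filter_upwards [self_mem_nhdsWithin] with w hw using
        fun i => mulBound_compGrad hg (hB' w hw) i
    · exact Eventually.of_forall fun x => (hVz z (g x)).continuousAt.continuousWithinAt
    · exact fun i => Eventually.of_forall fun x =>
        ((hV'z z (g x)).continuousAt.continuousWithinAt.tendsto).mul_const _
    · filter_upwards [self_mem_nhdsWithin] with w hw using hΦ w hw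
  · intro z hz
    -- Radius 2r: circles of radius r about points of the ball of radius r stay in S.
    obtain ⟨r, hr, hrS⟩ : ∃ r > 0, Metric.ball z (2 * r) ⊆ S := by
      obtain ⟨r, hr, hrS⟩ := Metric.isOpen_iff.1 isOpen_interior z hz
      exact ⟨r / 2, by positivity, by
        rw [mul_div_cancel₀ r two_ne_zero]
        exact hrS.trans interior_subset⟩
    have hzS : z ∈ S := interior_subset hz
    -- Cauchy's estimate, at fixed t, bounds z-derivatives by the bounds on the family itself, with
    -- the same exponential weight in t.
    have cauchy : ∀ {W W' : ℂ → ℝ → ℂ}, (∀ z t, HasDerivAt (fun w => W w t) (W' z t) z) →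
        (∀ z ∈ S, ∀ t, ‖W z t‖ * Real.exp (κ * t / p.toReal) ≤ B) →
        ∀ w ∈ Metric.ball z r, ∀ t, ‖W' w t‖ * Real.exp (κ * t / p.toReal) ≤ B / r := by
      intro W W' hW hb w hw t
      have hdiff : Differentiable ℂ fun w => W w t := fun w => (hW w t).differentiableAt
      have := Complex.norm_deriv_le_of_forall_mem_sphere_norm_le (c := w) (f := fun w => W w t)
        (C := B / Real.exp (κ * t / p.toReal)) hr hdiff.diffContOnCl (fun ζ hζ => by
          rw [le_div_iff₀ (Real.exp_pos _)]
          refine hb ζ (hrS ?_) t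
          rw [Metric.mem_ball] at hw ⊢
          rw [Metric.mem_sphere] at hζ
          linarith [dist_triangle ζ w z])
      rw [(hW w t).deriv, div_right_comm, le_div_iff₀ (Real.exp_pos _)] at this
      exact this
    -- By the mean value inequality the difference quotients obey the same bound uniformly in w, as
    -- dominated convergence requires.
    have slope : ∀ {W W' : ℂ → ℝ → ℂ}, (∀ z t, HasDerivAt (fun w => W w t) (W' z t) z) →
        (∀ z ∈ S, ∀ t, ‖W z t‖ * Real.exp (κ * t / p.toReal) ≤ B) →
        ∀ w ∈ Metric.ball z r, ∀ t,
          ‖(w - z)⁻¹ * (W w t - W z t)‖ * Real.exp (κ * t / p.toReal) ≤ B / r := by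
      intro W W' hW hb w hw t
      have h1 := Convex.norm_image_sub_le_of_norm_hasDerivWithin_le (x := z) (y := w)
        (C := B / r / Real.exp (κ * t / p.toReal)) (f := fun w => W w t) (s := Metric.ball z r)
        (fun ζ _ => (hW ζ t).hasDerivWithinAt) (fun ζ hζ => by
          rw [le_div_iff₀ (Real.exp_pos _)]
          exact cauchy hW hb ζ hζ t) (convex_ball z r) (Metric.mem_ball_self hr) hw
      rw [norm_mul, norm_inv, ← le_div_iff₀ (Real.exp_pos _)]
      by_cases hwz : w - z = 0
      · rw [hwz, norm_zero, inv_zero, zero_mul]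
        positivity
      · rw [inv_mul_le_iff₀ (norm_pos_iff.2 hwz), mul_comm]
        exact h1
    -- The candidate derivative is the multiple of F by D z (g). As `D'` is both the t-derivative of
    -- `D` and the z-derivative of `V'`, applying `cauchy` to `V'` controls the gradient of this
    -- multiplier.
    obtain ⟨ψ, hψ⟩ := hex (hD z) (hD'c z) (cauchy hVz hB z (Metric.mem_ball_self hr))
      (cauchy hV'z hB' z (Metric.mem_ball_self hr))
    have hder : HasDerivAt Φ ψ z := by
      rw [hasDerivAt_iff_tendsto_slope]
      refine (j.isometry.isEmbedding.isInducing.tendsto_nhds_iff).2 ?_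
      have hball : ∀ᶠ w in 𝓝[≠] z, w ∈ Metric.ball z r :=
        eventually_nhdsWithin_of_eventually_nhds (Metric.ball_mem_nhds z hr)
      have hcg : ∀ w i x, (w - z)⁻¹ * (compGrad g (V' w) i x - compGrad g (V' z) i x) =
          compGrad g (fun t => (w - z)⁻¹ * (V' w t - V' z t)) i x := fun w i x => by
        simp only [compGrad]
        ring
      refine IsMul.tendsto (C := B / r * (L + 1)) hp hG hω
        (H := fun w x => (w - z)⁻¹ * (V w (g x) - V z (g x)))
        (K := fun w i x => (w - z)⁻¹ * (compGrad g (V' w) i x - compGrad g (V' z) i x)) ?_ ?_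
        (mulBound_comp (cauchy hVz hB z (Metric.mem_ball_self hr)))
        (fun i => mulBound_compGrad hg (cauchy hV'z hB' z (Metric.mem_ball_self hr)) i)
        ?_ ?_ ?_ hψ
      · filter_upwards [hball] with w hw
        exact mulBound_comp (u := fun t => (w - z)⁻¹ * (V w t - V z t)) (slope hVz hB w hw)
      · filter_upwards [hball] with w hw i
        simp only [hcg]
        exact mulBound_compGrad hg (slope hV'z hB' w hw) i
      · exact Eventually.of_forall fun x => hasDerivAt_iff_tendsto_slope.1 (hVz z (g x))
      · refine fun i => Eventually.of_forall fun x => ?_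
        simp only [hcg]
        exact (hasDerivAt_iff_tendsto_slope.1 (hV'z z (g x))).mul_const _
      · filter_upwards [hball] with w hw
        have hwS : w ∈ S := hrS (Metric.ball_subset_ball (by linarith) hw)
        have := ((hΦ w hwS).sub_left (hΦ z hzS)).smul_left ((w - z)⁻¹)
        rw [← map_sub, ← map_smul] at this
        exact this
    exact hder.differentiableAt.differentiableWithinAt
  · intro z hz
    rw [← j.norm_map]
    exact (hΦ z hz).norm_le hp hG hω
      ((LipschitzOnBalls.comp_lipschitzWith (contDiff_one_of_hasDerivAt (hV z) (hV'c z))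
        hg).continuous.aestronglyMeasurable)
      (fun i => compGrad_aestronglyMeasurable hg (hV'c z) i) (by positivity)
      (mulBound_comp (hB z hz)) (fun i => mulBound_compGrad hg (hB' z hz) i)

/-! ### Estimates and derivatives for the Gaussian-damped exponential. -/

section ExponentialFamily

variable {a θ ζ : ℝ} {s s' : ℝ → ℝ}

/-- The multiplier `e^{z² - θ²} e^{a (z - θ) t} s(t)`. -/
def expMul (a θ : ℝ) (s : ℝ → ℝ) (z : ℂ) (t : ℝ) : ℂ :=
  Complex.exp (z ^ 2 - (θ : ℂ) ^ 2 + a * (z - θ) * t) * s t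

/-- The derivative in `t` of `expMul`. -/
def expMulDeriv (a θ : ℝ) (s s' : ℝ → ℝ) (z : ℂ) (t : ℝ) : ℂ :=
  Complex.exp (z ^ 2 - (θ : ℂ) ^ 2 + a * (z - θ) * t) * (a * (z - θ) * s t + s' t)

/-- In applications ζ ∈ {0, 1} is the endpoint of the target weight ω_ζ = ω_θ e^{(θ-ζ)g}, and a =
1/p. The parameter θ cancels from the coefficient of t, so that only Re z - ζ remains. -/
lemma norm_exp_expMul (z : ℂ) (t : ℝ) :
    ‖Complex.exp (z ^ 2 - (θ : ℂ) ^ 2 + a * (z - θ) * t)‖ * Real.exp ((θ - ζ) * t * a) =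
      Real.exp (z.re ^ 2 - z.im ^ 2 - θ ^ 2) * Real.exp (a * (z.re - ζ) * t) := by
  rw [Complex.norm_exp, ← Real.exp_add, ← Real.exp_add]
  congr 1
  simp [pow_two]
  ring

/-- The Gaussian beats linear growth: 3e^{y²} ≥ 3(1+y²) ≥ 2+|y|. The factor 2+|y| is the one that
the t-derivative of the multiplier produces. -/
lemma exp_sq_bound {x : ℝ} (hx : x ∈ Icc (0 : ℝ) 1) (y : ℝ) :
    Real.exp (x ^ 2 - y ^ 2 - θ ^ 2) * (2 + |y|) ≤ 3 * Real.exp 1 := by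
  have h1 : Real.exp (x ^ 2 - y ^ 2 - θ ^ 2) ≤ Real.exp 1 * Real.exp (-y ^ 2) := by
    rw [← Real.exp_add, Real.exp_le_exp]
    nlinarith [hx.1, hx.2, sq_nonneg θ]
  have h2 : Real.exp (-y ^ 2) * (2 + |y|) ≤ 3 := by
    rw [Real.exp_neg, inv_mul_le_iff₀ (Real.exp_pos _)]
    have := Real.add_one_le_exp (y ^ 2)
    have h3 : |y| ^ 2 = y ^ 2 := sq_abs y
    nlinarith [sq_nonneg (|y| - 1)]
  calc _ ≤ Real.exp 1 * Real.exp (-y ^ 2) * (2 + |y|) := by gcongr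
    _ = Real.exp 1 * (Real.exp (-y ^ 2) * (2 + |y|)) := by ring
    _ ≤ Real.exp 1 * 3 := by gcongr
    _ = _ := mul_comm _ _

lemma expMul_bound {z : ℂ} (hz : z.re ∈ Icc (0 : ℝ) 1)
    (hs : ∀ t, |s t| * Real.exp (a * (z.re - ζ) * t) ≤ 1) (t : ℝ) :
    ‖expMul a θ s z t‖ * Real.exp ((θ - ζ) * t * a) ≤ 3 * Real.exp 1 := by
  rw [expMul, norm_mul, mul_right_comm, norm_exp_expMul, Complex.norm_real, Real.norm_eq_abs,
    mul_assoc, mul_comm (Real.exp (a * _ * _))]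
  refine le_trans ?_ (exp_sq_bound (θ := θ) hz z.im)
  gcongr
  exact (hs t).trans (by linarith [abs_nonneg z.im])

/-- Differentiation in t brings down a(z-θ), of size at most 1+|Im z|, and replacing s by s' costs
at most |s|; the resulting factor 2+|Im z| is absorbed by `exp_sq_bound`. -/
lemma expMulDeriv_bound (ha : a ∈ Icc (0 : ℝ) 1) (hθ : θ ∈ Icc (0 : ℝ) 1) {z : ℂ}
    (hz : z.re ∈ Icc (0 : ℝ) 1)
    (hs : ∀ t, |s t| * Real.exp (a * (z.re - ζ) * t) ≤ 1) (hs' : ∀ t, |s' t| ≤ |s t|) (t : ℝ) :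
    ‖expMulDeriv a θ s s' z t‖ * Real.exp ((θ - ζ) * t * a) ≤ 3 * Real.exp 1 := by
  rw [expMulDeriv, norm_mul, mul_right_comm, norm_exp_expMul, mul_assoc]
  refine le_trans ?_ (exp_sq_bound (θ := θ) hz z.im)
  gcongr
  have h1 : ‖z - θ‖ ≤ 1 + |z.im| := by
    refine (Complex.norm_le_abs_re_add_abs_im _).trans ?_
    simp only [Complex.sub_re, Complex.ofReal_re, Complex.sub_im, Complex.ofReal_im, sub_zero]
    gcongr
    rw [abs_le]
    constructor <;> linarith [hz.1, hz.2, hθ.1, hθ.2]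
  have h2 : ‖(a : ℂ) * (z - θ) * s t + s' t‖ ≤ |s t| * (2 + |z.im|) := by
    refine (norm_add_le _ _).trans ?_
    rw [norm_mul, norm_mul, Complex.norm_real, Complex.norm_real, Complex.norm_real,
      Real.norm_eq_abs, Real.norm_eq_abs, Real.norm_eq_abs, abs_of_nonneg ha.1]
    have h3 : a * ‖z - θ‖ ≤ 1 * (1 + |z.im|) := mul_le_mul ha.2 h1 (norm_nonneg _) zero_le_one
    nlinarith [abs_nonneg (s t), hs' t]
  calc _ ≤ Real.exp (a * (z.re - ζ) * t) * (|s t| * (2 + |z.im|)) := by gcongr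
    _ = |s t| * Real.exp (a * (z.re - ζ) * t) * (2 + |z.im|) := by ring
    _ ≤ 1 * (2 + |z.im|) := by
        gcongr
        exact hs t
    _ = _ := one_mul _

lemma hasDerivAt_expMul (hs : ∀ t, HasDerivAt s (s' t) t) (z : ℂ) (t : ℝ) :
    HasDerivAt (expMul a θ s z) (expMulDeriv a θ s s' z t) t := by
  have h1 : HasDerivAt (fun t : ℝ => z ^ 2 - (θ : ℂ) ^ 2 + a * (z - θ) * (t : ℂ))
      (a * (z - θ) * 1) t :=
    (((hasDerivAt_id t).ofReal_comp).const_mul _).const_add _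
  refine (h1.cexp.mul (hs t).ofReal_comp).congr_deriv ?_
  simp only [expMulDeriv]
  ring

lemma hasDerivAt_expMul_left (z : ℂ) (t : ℝ) :
    HasDerivAt (fun w => expMul a θ s w t) ((2 * z + a * t) * expMul a θ s z t) z := by
  have h1 : HasDerivAt (fun z : ℂ => z ^ 2 - (θ : ℂ) ^ 2 + a * (z - θ) * (t : ℂ))
      (2 * z + a * t) z := by
    refine ((((hasDerivAt_pow 2 z).sub_const _).add
      ((((hasDerivAt_id z).sub_const (θ : ℂ)).const_mul (a : ℂ)).mul_const (t : ℂ)))).congr_deriv ?_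
    simp
  refine (h1.cexp.mul_const _).congr_deriv ?_
  simp only [expMul]
  ring

lemma hasDerivAt_expMulDeriv_left (z : ℂ) (t : ℝ) :
    HasDerivAt (fun w => expMulDeriv a θ s s' w t)
      (a * expMul a θ s z t + (2 * z + a * t) * expMulDeriv a θ s s' z t) z := by
  have h1 : HasDerivAt (fun z : ℂ => z ^ 2 - (θ : ℂ) ^ 2 + a * (z - θ) * (t : ℂ))
      (2 * z + a * t) z := by
    refine ((((hasDerivAt_pow 2 z).sub_const _).add
      ((((hasDerivAt_id z).sub_const (θ : ℂ)).const_mul (a : ℂ)).mul_const (t : ℂ)))).congr_deriv ?_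
    simp
  have h2 : HasDerivAt (fun z : ℂ => a * (z - θ) * s t + s' t) (a * 1 * s t) z :=
    ((((hasDerivAt_id z).sub_const (θ : ℂ)).const_mul (a : ℂ)).mul_const (s t : ℂ)).add_const _
  refine (h1.cexp.mul h2).congr_deriv ?_
  simp only [expMul, expMulDeriv]
  ring

/-- The same mixed derivative as in `hasDerivAt_expMulDeriv_left`, taken in the other order;
`exists_mulFamily` requires both. -/
lemma hasDerivAt_mul_expMul (hs : ∀ t, HasDerivAt s (s' t) t) (z : ℂ) (t : ℝ) :
    HasDerivAt (fun t : ℝ => (2 * z + a * t) * expMul a θ s z t)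
      (a * expMul a θ s z t + (2 * z + a * t) * expMulDeriv a θ s s' z t) t := by
  have h1 : HasDerivAt (fun t : ℝ => 2 * z + a * (t : ℂ)) (a * 1) t :=
    (((hasDerivAt_id t).ofReal_comp).const_mul _).const_add _
  refine (h1.mul (hasDerivAt_expMul hs z t)).congr_deriv ?_
  ring

lemma continuous_expMulDeriv (hs : ∀ t, HasDerivAt s (s' t) t) (hs' : Continuous s') (z : ℂ) :
    Continuous (expMulDeriv a θ s s' z) := by
  have : Continuous s := continuous_iff_continuousAt.2 fun t => (hs t).continuousAt
  unfold expMulDeriv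
  fun_prop

lemma continuous_expMul (hs : ∀ t, HasDerivAt s (s' t) t) (z : ℂ) :
    Continuous (expMul a θ s z) := by
  have : Continuous s := continuous_iff_continuousAt.2 fun t => (hs t).continuousAt
  unfold expMul
  fun_prop

end ExponentialFamily

/-- The family `e^{z² - θ²} e^{(z - θ) g / p} s(g) φ` for `φ ∈ W^{1,p}(U, ω)`. -/
lemma exists_expFamily (hp : p ≠ ∞) (hg : LipschitzWith L g) {θ ζ : ℝ} (hθ : θ ∈ Icc (0 : ℝ) 1)
    (hω : ∀ x ∈ U, ω'.toFun x = ω.toFun x * Real.exp ((θ - ζ) * g x)) {S : Set ℂ}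
    (hS : S ⊆ ComplexInterp.strip) {s s' : ℝ → ℝ} (hs : ∀ t, HasDerivAt s (s' t) t)
    (hs' : Continuous s') (hs's : ∀ t, |s' t| ≤ |s t|)
    (hsS : ∀ z ∈ S, ∀ t, |s t| * Real.exp ((p.toReal)⁻¹ * (z.re - ζ) * t) ≤ 1)
    {A : Type*} [NormedAddCommGroup A] [NormedSpace ℂ A] (j : A →ₗᵢ[ℂ] Sobolev p ω')
    (F : Sobolev p ω) (hj : MulStable (fun x => (θ - ζ) * g x) F (Set.range j)) :
    ∃ Φ : ℂ → A, (∀ z ∈ S, sobolevIncl p ω' (j (Φ z)) =ᵐ[volume.restrict (U : Set (E d))]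
        fun x => expMul (p.toReal)⁻¹ θ s z (g x) * sobolevIncl p ω F x) ∧
      ContinuousOn Φ S ∧ DifferentiableOn ℂ Φ (interior S) ∧
      ∀ z ∈ S, ‖Φ z‖ ≤ (d + 1) * (2 * (3 * Real.exp 1 * (L + 1)) * ‖F‖) := by
  have hp1 : 1 ≤ p.toReal := by
    have := ENNReal.toReal_mono hp (Fact.out : 1 ≤ p)
    simpa using this
  have ha : (p.toReal)⁻¹ ∈ Icc (0 : ℝ) 1 := ⟨by positivity, inv_le_one_of_one_le₀ hp1⟩
  obtain ⟨Φ, h1, h2, h3, h4⟩ := exists_mulFamily (S := S) (B := 3 * Real.exp 1) hp hg hω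
    (by positivity) (V := expMul (p.toReal)⁻¹ θ s) (V' := expMulDeriv (p.toReal)⁻¹ θ s s')
    (hasDerivAt_expMul hs) (continuous_expMulDeriv hs hs') (hasDerivAt_mul_expMul hs)
    (fun z => (continuous_const.mul (continuous_expMul hs z)).add
      (Continuous.mul (by fun_prop) (continuous_expMulDeriv hs hs' z)))
    hasDerivAt_expMul_left hasDerivAt_expMulDeriv_left
    (fun z hz t => by
      rw [div_eq_mul_inv]
      exact expMul_bound (hS hz) (hsS z hz) t)
    (fun z hz t => by
      rw [div_eq_mul_inv]
      exact expMulDeriv_bound ha hθ (hS hz) (hsS z hz) hs's t)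
    j F hj
  refine ⟨Φ, fun z hz => ?_, h2, h3, h4⟩
  filter_upwards [sobolevIncl_ae (j (Φ z)), sobolevIncl_ae F, (h1 z hz).1] with x e1 e2 e3
  rw [e1, e2, e3]

end WSob

/-! ### Weights related by e^g. -/

namespace WSob

variable {d : ℕ} {U : TopologicalSpace.Opens (E d)} {p : ℝ≥0∞} [Fact (1 ≤ p)]
  {ω ω₀ ω₁ : Weight U} {g : E d → ℝ} {L : ℝ≥0} {θ : ℝ}

section Weights

lemma Weight.interp_eq (hω : ∀ x ∈ U, ω₀.toFun x = ω₁.toFun x * Real.exp (g x)) (θ : ℝ) :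
    ∀ x ∈ U, (ω₀.interp ω₁ θ).toFun x = ω₁.toFun x * Real.exp ((1 - θ) * g x) := by
  intro x hx
  have h1 := ω₁.pos x hx
  change ω₀.toFun x ^ (1 - θ) * ω₁.toFun x ^ θ = _
  rw [hω x hx, Real.mul_rpow h1.le (Real.exp_pos _).le, ← Real.exp_mul, mul_right_comm,
    ← Real.rpow_add h1, sub_add_cancel, Real.rpow_one, mul_comm (g x)]

/-- The exponent is left as θ - 0, and below as θ - 1, to match θ - ζ in `exists_expFamily`. -/
lemma Weight.left_eq_interp (hω : ∀ x ∈ U, ω₀.toFun x = ω₁.toFun x * Real.exp (g x)) (θ : ℝ) :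
    ∀ x ∈ U, ω₀.toFun x = (ω₀.interp ω₁ θ).toFun x * Real.exp ((θ - 0) * g x) := by
  intro x hx
  rw [Weight.interp_eq hω θ x hx, mul_assoc, ← Real.exp_add, hω x hx]
  ring_nf

lemma Weight.right_eq_interp (hω : ∀ x ∈ U, ω₀.toFun x = ω₁.toFun x * Real.exp (g x)) (θ : ℝ) :
    ∀ x ∈ U, ω₁.toFun x = (ω₀.interp ω₁ θ).toFun x * Real.exp ((θ - 1) * g x) := by
  intro x hx
  rw [Weight.interp_eq hω θ x hx, mul_assoc, ← Real.exp_add]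
  ring_nf
  simp

lemma Weight.compactlyBounded_of_eq_mul_exp (hg : Continuous g)
    (hω : ∀ x ∈ U, ω₀.toFun x = ω₁.toFun x * Real.exp (g x)) (h : ω₁.CompactlyBounded) :
    ω₀.CompactlyBounded := by
  intro K hK hKU
  obtain ⟨m, M, hm, hmM⟩ := h K hK hKU
  obtain ⟨B, hB⟩ := hK.exists_bound_of_continuousOn hg.continuousOn
  refine ⟨m * Real.exp (-B), |M| * Real.exp B, by positivity, fun x hx => ?_⟩
  obtain ⟨h1, h2⟩ := hmM x hx
  obtain ⟨h3, h4⟩ := abs_le.1 (hB x hx)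
  rw [hω x (hKU hx)]
  have := hm.trans_le h1
  constructor
  · gcongr
  · gcongr
    exact h2.trans (le_abs_self M)

lemma locLipschitzOn_ratio (hg : LipschitzWith L g)
    (hω : ∀ x ∈ U, ω₀.toFun x = ω₁.toFun x * Real.exp (g x)) :
    LocLipschitzOn U (ω₀.ratio ω₁) := by
  intro K hK hKU
  obtain ⟨R, hR⟩ := hK.isBounded.subset_ball (0 : E d)
  obtain ⟨C, hC⟩ := LipschitzOnBalls.comp_lipschitzWith (u := Real.exp) Real.contDiff_exp hg R
  refine ⟨C, fun x hx y hy => ?_⟩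
  have e : ∀ x ∈ K, ω₀.ratio ω₁ x = Real.exp (g x) := fun x hx => by
    rw [Weight.ratio, hω x (hKU hx), mul_div_cancel_left₀ _ (ω₁.pos x (hKU hx)).ne']
  rw [e x hx, e y hy]
  exact hC (hR hx) (hR hy)

end Weights

/-! ### The logistic splitting between the two endpoint spaces. -/

section Logistic

/-- The decreasing logistic function. -/
def logistic (t : ℝ) : ℝ := (1 + Real.exp t)⁻¹

/-- The derivative of the decreasing logistic function. -/
def logisticDeriv (t : ℝ) : ℝ := -Real.exp t / (1 + Real.exp t) ^ 2

lemma hasDerivAt_logistic (t : ℝ) : HasDerivAt logistic (logisticDeriv t) t :=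
  ((Real.hasDerivAt_exp t).const_add 1).inv (by positivity)

lemma continuous_logisticDeriv : Continuous logisticDeriv := by
  unfold logisticDeriv
  exact Continuous.div (by fun_prop) (by fun_prop) fun t => by positivity

lemma one_sub_logistic (t : ℝ) : 1 - logistic t = Real.exp t * logistic t := by
  unfold logistic
  field_simp
  ring

lemma logistic_pos (t : ℝ) : 0 < logistic t := by
  unfold logistic
  positivity

/-- The product form bounds |s'| both by s and by 1-s, so both pieces of the splitting satisfy the
condition |s'| ≤ |s| of `exists_expFamily`. -/
lemma abs_logisticDeriv (t : ℝ) : |logisticDeriv t| = logistic t * (1 - logistic t) := by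
  rw [one_sub_logistic, logisticDeriv, abs_div, abs_neg, abs_of_pos (Real.exp_pos t),
    abs_of_pos (by positivity : (0 : ℝ) < (1 + Real.exp t) ^ 2), logistic]
  field_simp

lemma one_sub_logistic_pos (t : ℝ) : 0 < 1 - logistic t := by
  rw [one_sub_logistic]
  exact mul_pos (Real.exp_pos t) (logistic_pos t)

/-- e^{ct} ≤ max(1, e^t) < 1 + e^t. This keeps the piece s(g)f(z) bounded in the space with weight
ω₀ for every z in the strip. -/
lemma logistic_mul_exp_le {c : ℝ} (hc : c ∈ Icc (0 : ℝ) 1) (t : ℝ) :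
    logistic t * Real.exp (c * t) ≤ 1 := by
  rw [logistic, inv_mul_le_iff₀ (by positivity), mul_one]
  rcases le_total t 0 with ht | ht
  · have : Real.exp (c * t) ≤ 1 := Real.exp_le_one_iff.2 (mul_nonpos_of_nonneg_of_nonpos hc.1 ht)
    linarith [Real.exp_pos t]
  · have : Real.exp (c * t) ≤ Real.exp t := Real.exp_le_exp.2 (mul_le_of_le_one_left ht hc.2)
    linarith

end Logistic

/-! ### The two inclusions and the abstract interpolation theorem. -/

section Main

variable {A₀ A₁ A : Type*} [NormedAddCommGroup A₀] [NormedSpace ℂ A₀] [NormedAddCommGroup A₁]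
  [NormedSpace ℂ A₁] [NormedAddCommGroup A] [NormedSpace ℂ A]

/-- The elements of `W^{1,p}(U, ω_θ)` belong to the interpolation space. -/
lemma exists_calderonFunction_of_sobolev (hp : p ≠ ∞) (hg : LipschitzWith L g)
    (hω : ∀ x ∈ U, ω₀.toFun x = ω₁.toFun x * Real.exp (g x)) (hθ : θ ∈ Icc (0 : ℝ) 1)
    (j₀ : A₀ →ₗᵢ[ℂ] Sobolev p ω₀) (j₁ : A₁ →ₗᵢ[ℂ] Sobolev p ω₁)
    (F : Sobolev p (ω₀.interp ω₁ θ))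
    (h₀ : MulStable (fun x => (θ - 0) * g x) F (Set.range j₀))
    (h₁ : MulStable (fun x => (θ - 1) * g x) F (Set.range j₁)) :
    ∃ f : ComplexInterp.CalderonFunction (sobolevIncl p ω₀ ∘ₗ j₀.toLinearMap)
        (sobolevIncl p ω₁ ∘ₗ j₁.toLinearMap),
      ComplexInterp.SumSpace.toAmbient _ _ (f.toFun θ) = sobolevIncl p (ω₀.interp ω₁ θ) F ∧
      f.norm ≤ (d + 1) * (2 * (3 * Real.exp 1 * (L + 1)) * ‖F‖) := by
  have hp1 : 1 ≤ p.toReal := by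
    have := ENNReal.toReal_mono hp (Fact.out : 1 ≤ p)
    simpa using this
  have ha0 : 0 ≤ (p.toReal)⁻¹ := by positivity
  have ha1 : (p.toReal)⁻¹ ≤ 1 := inv_le_one_of_one_le₀ hp1
  have hw₀ := Weight.left_eq_interp hω θ
  have hw₁ := Weight.right_eq_interp hω θ
  have hone : ∀ t : ℝ, HasDerivAt (fun _ : ℝ => (1 : ℝ)) 0 t := fun t => hasDerivAt_const t 1
  obtain ⟨Φ₀, e₀, c₀, d₀, b₀⟩ := exists_expFamily (S := ComplexInterp.strip) hp hg hθ hw₀ le_rfl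
    hasDerivAt_logistic continuous_logisticDeriv
    (fun t => by
      rw [abs_logisticDeriv, abs_of_pos (logistic_pos t)]
      exact mul_le_of_le_one_right (logistic_pos t).le (by linarith [logistic_pos t]))
    (fun z hz t => by
      rw [abs_of_pos (logistic_pos t), sub_zero]
      exact logistic_mul_exp_le ⟨mul_nonneg ha0 hz.1, mul_le_one₀ ha1 hz.1 hz.2⟩ t) j₀ F h₀
  obtain ⟨Φ₁, e₁, c₁, d₁, b₁⟩ := exists_expFamily (S := ComplexInterp.strip) hp hg hθ hw₁ le_rfl
    (s := fun t => 1 - logistic t) (s' := fun t => -logisticDeriv t)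
    (fun t => (hasDerivAt_logistic t).const_sub 1) continuous_logisticDeriv.neg
    (fun t => by
      rw [abs_neg, abs_logisticDeriv, abs_of_pos (one_sub_logistic_pos t)]
      exact mul_le_of_le_one_left (one_sub_logistic_pos t).le
        (by linarith [one_sub_logistic_pos t]))
    (fun z hz t => by
      rw [abs_of_pos (one_sub_logistic_pos t), one_sub_logistic, mul_comm (Real.exp t), mul_assoc,
        ← Real.exp_add]
      -- Since 1-s(t) = e^t s(t), the bound for the second piece is the logistic one with c =
      -- 1-(1-Re z)/p, which lies in [0,1].
      have h1 : (p.toReal)⁻¹ * (1 - z.re) ≤ 1 :=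
        mul_le_one₀ ha1 (by linarith [hz.2]) (by linarith [hz.1])
      have h2 : 0 ≤ (p.toReal)⁻¹ * (1 - z.re) := mul_nonneg ha0 (by linarith [hz.2])
      convert logistic_mul_exp_le (c := 1 - (p.toReal)⁻¹ * (1 - z.re))
        ⟨by linarith, by linarith⟩ t using 3
      ring) j₁ F h₁
  -- On a boundary line the whole family, unsplit (s = 1), is bounded in the endpoint space. The
  -- line has empty interior, so nothing is lost by discarding differentiability.
  obtain ⟨Ψ₀, e₀', c₀', -, b₀'⟩ := exists_expFamily (S := {z | z.re = 0}) hp hg hθ hw₀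
    (fun z (hz : z.re = 0) => by simp [ComplexInterp.strip, hz]) hone continuous_const (by simp)
    (fun z (hz : z.re = 0) t => by simp [hz]) j₀ F h₀
  obtain ⟨Ψ₁, e₁', c₁', -, b₁'⟩ := exists_expFamily (S := {z | z.re = 1}) hp hg hθ hw₁
    (fun z (hz : z.re = 1) => by simp [ComplexInterp.strip, hz]) hone continuous_const (by simp)
    (fun z (hz : z.re = 1) t => by simp [hz]) j₁ F h₁
  have hsum : ∀ z ∈ ComplexInterp.strip,
      (sobolevIncl p ω₀ (j₀ (Φ₀ z)) + sobolevIncl p ω₁ (j₁ (Φ₁ z)) : Fun U)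
        =ᵐ[volume.restrict (U : Set (E d))] fun x => expMul (p.toReal)⁻¹ θ (fun _ => 1) z (g x) *
          sobolevIncl p (ω₀.interp ω₁ θ) F x := by
    intro z hz
    filter_upwards [AEEqFun.coeFn_add (sobolevIncl p ω₀ (j₀ (Φ₀ z)))
      (sobolevIncl p ω₁ (j₁ (Φ₁ z))), e₀ z hz, e₁ z hz] with x h1 h2 h3
    rw [h1, Pi.add_apply, h2, h3]
    simp only [expMul]
    push_cast
    ring
  obtain ⟨f, hf, hf'⟩ := ComplexInterp.exists_calderonFunction
    (ι₀ := sobolevIncl p ω₀ ∘ₗ j₀.toLinearMap) (ι₁ := sobolevIncl p ω₁ ∘ₗ j₁.toLinearMap)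
    Φ₀ Φ₁ Ψ₀ Ψ₁ (C := (d + 1) * (2 * (3 * Real.exp 1 * (L + 1)) * ‖F‖)) (by positivity)
    c₀ c₁ d₀ d₁ b₀ b₁ c₀' c₁' b₀' b₁'
    (fun z hz => AEEqFun.ext ((hsum z (by simp [ComplexInterp.strip, hz])).trans
      (e₀' z hz).symm))
    (fun z hz => AEEqFun.ext ((hsum z (by simp [ComplexInterp.strip, hz])).trans
      (e₁' z hz).symm))
  refine ⟨f, ?_, hf⟩
  rw [hf']
  refine AEEqFun.ext ((hsum θ (by simpa [ComplexInterp.strip] using hθ)).trans ?_)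
  exact Eventually.of_forall fun x => by simp [expMul]

/-- The values at `θ` of Calderon functions belong to `W^{1,p}(U, ω_θ)`. -/
lemma exists_sobolev_of_calderonFunction (hp : p ≠ ∞) (hg : LipschitzWith L g)
    (hω : ∀ x ∈ U, ω₀.toFun x = ω₁.toFun x * Real.exp (g x)) (hθ : θ ∈ Icc (0 : ℝ) 1)
    (j₀ : A₀ →ₗᵢ[ℂ] Sobolev p ω₀) (j₁ : A₁ →ₗᵢ[ℂ] Sobolev p ω₁)
    (f : ComplexInterp.CalderonFunction (sobolevIncl p ω₀ ∘ₗ j₀.toLinearMap)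
        (sobolevIncl p ω₁ ∘ₗ j₁.toLinearMap)) :
    ∃ (F : Sobolev p (ω₀.interp ω₁ θ)) (a₀ : A₀) (a₁ : A₁),
      sobolevIncl p (ω₀.interp ω₁ θ) F = ComplexInterp.SumSpace.toAmbient _ _ (f.toFun θ) ∧
      sobolevIncl p (ω₀.interp ω₁ θ) F = sobolevIncl p ω₀ (j₀ a₀) + sobolevIncl p ω₁ (j₁ a₁) ∧
      ‖F‖ ≤ (d + 1) * f.norm := by
  obtain ⟨a, ha⟩ := ComplexInterp.SumSpace.exists_mkL_eq (f.toFun θ)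
  have hμ₀ := Weight.measure_eq_withDensity hg.continuous.measurable hω
  have hμθ := Weight.measure_eq_withDensity (hg.continuous.measurable.const_mul (1 - θ))
    (Weight.interp_eq hω θ)
  -- Uniqueness of weak derivatives makes each component, the partial derivatives included, well
  -- defined on A₀ + A₁.
  have hcompat : ∀ (c : Fin (d + 1)) (b₀ : A₀) (b₁ : A₁),
      (sobolevIncl p ω₀ ∘ₗ j₀.toLinearMap) b₀ + (sobolevIncl p ω₁ ∘ₗ j₁.toLinearMap) b₁ = 0 →
      (fun x => Sobolev.comp c (j₀ b₀) x + Sobolev.comp c (j₁ b₁) x) =ᵐ[ω₁.measure] 0 := by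
    intro c b₀ b₁ hb
    have hz : (Sobolev.comp 0 (j₀ b₀) + Sobolev.comp 0 (j₁ b₁) : E d → ℂ)
        =ᵐ[volume.restrict (U : Set (E d))] 0 := by
      have hb' : sobolevIncl p ω₀ (j₀ b₀) + sobolevIncl p ω₁ (j₁ b₁) = 0 := hb
      have h1 := AEEqFun.coeFn_add (sobolevIncl p ω₀ (j₀ b₀)) (sobolevIncl p ω₁ (j₁ b₁))
      rw [hb'] at h1
      filter_upwards [h1, sobolevIncl_ae (j₀ b₀), sobolevIncl_ae (j₁ b₁),
        AEEqFun.coeFn_zero (α := E d) (β := ℂ) (μ := volume.restrict (U : Set (E d)))] with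
        x e1 e2 e3 e4
      rw [Pi.add_apply, ← e2, ← e3, ← Pi.add_apply, ← e1, e4]
    refine ω₁.measure_ac.ae_eq ?_
    refine Fin.cases hz (fun i => ?_) c
    exact (((j₀ b₀).hasWeakPartial i).add ((j₁ b₁).hasWeakPartial i)).ae_eq_zero hz
  have hbound : ∀ c, eLpNorm (fun x => Sobolev.comp c (j₀ a.fst) x + Sobolev.comp c (j₁ a.snd) x)
      p (ω₀.interp ω₁ θ).measure ≤ ENNReal.ofReal f.norm := by
    intro c
    rw [hμθ]
    exact f.eLpNorm_le hp hg.continuous hμ₀ ((Sobolev.comp c).comp j₀.toContinuousLinearMap)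
      ((Sobolev.comp c).comp j₁.toContinuousLinearMap)
      (fun b => (Sobolev.norm_comp_le c (j₀ b)).trans_eq (j₀.norm_map b))
      (fun b => (Sobolev.norm_comp_le c (j₁ b)).trans_eq (j₁.norm_map b)) (hcompat c) hθ ha
  have hmem : ∀ c, MemLp (fun x => Sobolev.comp c (j₀ a.fst) x + Sobolev.comp c (j₁ a.snd) x)
      p (ω₀.interp ω₁ θ).measure := fun c =>
    ⟨((toFun_aesm ω₀ _).add (toFun_aesm ω₁ _)).mono_ac (ω₀.interp ω₁ θ).measure_ac,
      (hbound c).trans_lt ENNReal.ofReal_lt_top⟩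
  obtain ⟨F, hF⟩ := Sobolev.exists_of_memLp _ hmem
    fun i => ((j₀ a.fst).hasWeakPartial i).add ((j₁ a.snd).hasWeakPartial i)
  have hsum : sobolevIncl p (ω₀.interp ω₁ θ) F =
      sobolevIncl p ω₀ (j₀ a.fst) + sobolevIncl p ω₁ (j₁ a.snd) := by
    refine AEEqFun.ext ?_
    filter_upwards [AEEqFun.coeFn_add (sobolevIncl p ω₀ (j₀ a.fst))
      (sobolevIncl p ω₁ (j₁ a.snd)), sobolevIncl_ae F, sobolevIncl_ae (j₀ a.fst),
      sobolevIncl_ae (j₁ a.snd), hF 0] with x h1 h2 h3 h4 h5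
    rw [h1, Pi.add_apply, h2, h3, h4, h5]
  refine ⟨F, a.fst, a.snd, ?_, hsum, ?_⟩
  · rw [← ha]
    exact hsum
  · refine Sobolev.norm_le_of_comp hp f.norm_nonneg fun c => ?_
    rw [Lp.norm_def, eLpNorm_congr_ae ((ω₀.interp ω₁ θ).measure_ac.ae_eq (hF c))]
    exact ENNReal.toReal_le_of_le_ofReal f.norm_nonneg (hbound c)

/-- Interpolation of subspaces of weighted Sobolev spaces, the quotient of the weights being the
exponential of a Lipschitz function. -/
theorem eqUpToEquivNorms_of_mulStable (hp : p ≠ ∞) (hg : LipschitzWith L g)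
    (hω : ∀ x ∈ U, ω₀.toFun x = ω₁.toFun x * Real.exp (g x)) (hθ : θ ∈ Icc (0 : ℝ) 1)
    (j₀ : A₀ →ₗᵢ[ℂ] Sobolev p ω₀) (j₁ : A₁ →ₗᵢ[ℂ] Sobolev p ω₁)
    (j : A →ₗᵢ[ℂ] Sobolev p (ω₀.interp ω₁ θ))
    (h₀ : ∀ a, MulStable (fun x => (θ - 0) * g x) (j a) (Set.range j₀))
    (h₁ : ∀ a, MulStable (fun x => (θ - 1) * g x) (j a) (Set.range j₁))
    (h : ∀ (F : Sobolev p (ω₀.interp ω₁ θ)) (a₀ : A₀) (a₁ : A₁),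
      sobolevIncl p (ω₀.interp ω₁ θ) F = sobolevIncl p ω₀ (j₀ a₀) + sobolevIncl p ω₁ (j₁ a₁) →
      F ∈ Set.range j) :
    ComplexInterp.EqUpToEquivNorms (sobolevIncl p ω₀ ∘ₗ j₀.toLinearMap)
      (sobolevIncl p ω₁ ∘ₗ j₁.toLinearMap) θ
      (sobolevIncl p (ω₀.interp ω₁ θ) ∘ₗ j.toLinearMap) := by
  refine ComplexInterp.eqUpToEquivNorms_of_bounds (c := ((d : ℝ) + 1)⁻¹)
    (C := (d + 1) * (2 * (3 * Real.exp 1 * (L + 1)))) _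
    (sobolevIncl_injective.comp j.injective) (by positivity) (by positivity) (fun f => ?_)
    fun a => ?_
  · obtain ⟨F, a₀, a₁, hF, hF', hn⟩ := exists_sobolev_of_calderonFunction hp hg hω hθ j₀ j₁ f
    obtain ⟨a, rfl⟩ := h F a₀ a₁ hF'
    refine ⟨a, hF, ?_⟩
    rw [j.norm_map] at hn
    rwa [inv_mul_le_iff₀ (by positivity)]
  · obtain ⟨f, hf, hn⟩ :=
      exists_calderonFunction_of_sobolev hp hg hω hθ j₀ j₁ (j a) (h₀ a) (h₁ a)
    refine ⟨f, hf, hn.trans_eq ?_⟩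
    rw [j.norm_map]
    ring

end Main

/-! ### Cutoffs and membership in the closure of Lip_c. -/

section Cutoff

/-- A Lipschitz cutoff function, supported in the ball of radius `n + 1`. -/
def cutoff (n : ℕ) (x : E d) : ℂ := ((max 0 (1 - ‖x‖ / (n + 1)) : ℝ) : ℂ)

lemma cutoff_lipschitzWith (n : ℕ) :
    LipschitzWith ((n : ℝ≥0) + 1)⁻¹ (cutoff n : E d → ℂ) := by
  refine LipschitzWith.of_dist_le_mul fun x y => ?_
  rw [dist_eq_norm, cutoff, cutoff, ← Complex.ofReal_sub, Complex.norm_real, Real.norm_eq_abs]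
  refine (abs_max_sub_max_le_max _ _ _ _).trans ?_
  rw [sub_self, abs_zero, max_eq_right (abs_nonneg _), sub_sub_sub_cancel_left, ← sub_div, abs_div,
    abs_of_pos (by positivity : (0 : ℝ) < n + 1), abs_sub_comm]
  push_cast
  rw [div_eq_inv_mul, dist_eq_norm]
  gcongr
  exact abs_norm_sub_norm_le x y

lemma norm_cutoff_le_one (n : ℕ) (x : E d) : ‖cutoff n x‖ ≤ 1 := by
  rw [cutoff, Complex.norm_real, Real.norm_of_nonneg (le_max_left _ _)]
  refine max_le zero_le_one ?_
  have : 0 ≤ ‖x‖ / (n + 1) := by positivity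
  linarith

lemma norm_lineDeriv_cutoff_le (n : ℕ) (x : E d) (i : Fin d) :
    ‖lineDeriv ℝ (cutoff n) x (EuclideanSpace.single i 1)‖ ≤ ((n : ℝ) + 1)⁻¹ := by
  have := norm_lineDeriv_le_of_lipschitz ℝ (cutoff_lipschitzWith n) (x₀ := x)
    (v := EuclideanSpace.single i (1 : ℝ))
  simpa using this

lemma cutoff_eq_zero (n : ℕ) {x : E d} (hx : x ∉ Metric.closedBall (0 : E d) (n + 1)) :
    cutoff n x = 0 := by
  rw [Metric.mem_closedBall, dist_zero_right, not_le] at hx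
  rw [cutoff, max_eq_left, Complex.ofReal_zero]
  have : 1 ≤ ‖x‖ / (n + 1) := (one_le_div (by positivity)).2 hx.le
  linarith

lemma lineDeriv_cutoff_eq_zero (n : ℕ) {x : E d} (hx : x ∉ Metric.closedBall (0 : E d) (n + 1))
    (v : E d) : lineDeriv ℝ (cutoff n) x v = 0 := by
  have : cutoff n =ᶠ[𝓝 x] fun _ => (0 : ℂ) := by
    filter_upwards [Metric.isClosed_closedBall.isOpen_compl.mem_nhds hx] with y hy
    exact cutoff_eq_zero n hy
  rw [this.lineDeriv_eq]
  simp [lineDeriv]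

lemma tendsto_cutoff (x : E d) : Tendsto (fun n => cutoff n x) atTop (𝓝 1) := by
  have h1 : Tendsto (fun n : ℕ => ‖x‖ * (1 / ((n : ℝ) + 1))) atTop (𝓝 (‖x‖ * 0)) :=
    tendsto_one_div_add_atTop_nhds_zero_nat.const_mul _
  have h2 : Tendsto (fun n : ℕ => max 0 (1 - ‖x‖ * (1 / ((n : ℝ) + 1)))) atTop
      (𝓝 (max 0 (1 - ‖x‖ * 0))) := tendsto_const_nhds.max (h1.const_sub 1)
  have h3 := (Complex.continuous_ofReal.tendsto _).comp h2
  simp only [mul_zero, sub_zero, zero_le_one, sup_of_le_right, Complex.ofReal_one] at h3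
  refine h3.congr fun n => ?_
  simp [cutoff, div_eq_mul_inv]

lemma tendsto_lineDeriv_cutoff (x : E d) (i : Fin d) :
    Tendsto (fun n => lineDeriv ℝ (cutoff n) x (EuclideanSpace.single i 1)) atTop (𝓝 0) := by
  refine squeeze_zero_norm (fun n => norm_lineDeriv_cutoff_le n x i) ?_
  simpa using tendsto_one_div_add_atTop_nhds_zero_nat (𝕜 := ℝ)

omit [Fact (1 ≤ p)] in
-- The cutoff vanishes off a ball on which the continuous function e^{G/p} is bounded. The constant
-- depends on n, but is used only for membership.
lemma exists_mulBound_cutoff {G : E d → ℝ} (hG : Continuous G) (n : ℕ) :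
    ∃ C : ℝ, 0 ≤ C ∧ MulBound U p G C (cutoff n) ∧
      ∀ i, MulBound U p G C fun x => lineDeriv ℝ (cutoff n) x (EuclideanSpace.single i 1) := by
  obtain ⟨C, hC⟩ := (isCompact_closedBall (0 : E d) (n + 1)).exists_bound_of_continuousOn
    (f := fun x => Real.exp (G x / p.toReal)) (by fun_prop)
  have hC0 : 0 ≤ C := (norm_nonneg _).trans (hC 0 (by simp; positivity))
  refine ⟨C, hC0, Eventually.of_forall fun x => ?_, fun i => Eventually.of_forall fun x => ?_⟩
  · by_cases hx : x ∈ Metric.closedBall (0 : E d) (n + 1)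
    · have := mul_le_mul (norm_cutoff_le_one n x) ((le_abs_self _).trans (hC x hx))
        (Real.exp_pos _).le zero_le_one
      simpa using this
    · simpa [cutoff_eq_zero n hx] using hC0
  · by_cases hx : x ∈ Metric.closedBall (0 : E d) (n + 1)
    · have h1 : ‖lineDeriv ℝ (cutoff n) x (EuclideanSpace.single i 1)‖ ≤ 1 :=
        (norm_lineDeriv_cutoff_le n x i).trans (inv_le_one_of_one_le₀ (by simp))
      have := mul_le_mul h1 ((le_abs_self _).trans (hC x hx)) (Real.exp_pos _).le zero_le_one
      simpa using this
    · simpa [lineDeriv_cutoff_eq_zero n hx] using hC0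

lemma IsMul.one (F : Sobolev p ω) : IsMul (fun _ => 1) (fun _ _ => 0) F F :=
  ⟨Eventually.of_forall fun x => by simp, fun i => Eventually.of_forall fun x => by simp⟩

/-- A function of `W^{1,p}(U, ω)` that is the sum of elements of `W_0^{1,p}(U, ω₀)` and
`W_0^{1,p}(U, ω₁)` belongs to `W_0^{1,p}(U, ω)`, provided that the weights are comparable on
bounded sets. -/
lemma mem_sobolevZero_of_eq_add (hp : p ≠ ∞) {G₀ G₁ : E d → ℝ} (hG₀ : Continuous G₀)
    (hG₁ : Continuous G₁) (hω₀ : ∀ x ∈ U, ω.toFun x = ω₀.toFun x * Real.exp (G₀ x))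
    (hω₁ : ∀ x ∈ U, ω.toFun x = ω₁.toFun x * Real.exp (G₁ x)) {F : Sobolev p ω}
    {F₀ : Sobolev p ω₀} {F₁ : Sobolev p ω₁} (hF₀ : F₀ ∈ sobolevZero p ω₀)
    (hF₁ : F₁ ∈ sobolevZero p ω₁)
    (hF : sobolevIncl p ω F = sobolevIncl p ω₀ F₀ + sobolevIncl p ω₁ F₁) :
    F ∈ sobolevZero p ω := by
  have hl : ∀ n, LipschitzOnBalls (cutoff n : E d → ℂ) := fun n =>
    LipschitzOnBalls.of_lipschitzWith (cutoff_lipschitzWith n)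
  set K : ℕ → Fin d → E d → ℂ := fun n i x =>
    lineDeriv ℝ (cutoff n) x (EuclideanSpace.single i 1) with hK
  have hmul : ∀ {ω' : Weight U} {G : E d → ℝ}, Continuous G →
      (∀ x ∈ U, ω.toFun x = ω'.toFun x * Real.exp (G x)) → ∀ F' : Sobolev p ω',
      F' ∈ sobolevZero p ω' → ∀ n, ∃ F'' : Sobolev p ω, F'' ∈ sobolevZero p ω ∧
        IsMul (cutoff n) (K n) F' F'' := by
    intro ω' G hG hω F' hF' n
    obtain ⟨C, hC0, hC, hCk⟩ := exists_mulBound_cutoff (U := U) (p := p) hG n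
    obtain ⟨F'', hF''⟩ := exists_isMul hp hG.measurable hω (hl n)
      (fun i => EventuallyEq.rfl) hC hCk F'
    exact ⟨F'', hF''.mem_sobolevZero hp hG.measurable hω (hl n)
      (fun i => EventuallyEq.rfl) hC0 hC hCk hF', hF''⟩
  have hid : ∀ x ∈ U, ω.toFun x = ω.toFun x * Real.exp ((fun _ : E d => (0 : ℝ)) x) :=
    fun x _ => by simp
  have hb1 : ∀ n, MulBound U p (fun _ => 0) 1 (cutoff n : E d → ℂ) := fun n =>
    Eventually.of_forall fun x => by simpa using norm_cutoff_le_one n x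
  have hb2 : ∀ n i, MulBound U p (fun _ => 0) 1 (K n i) := fun n i =>
    Eventually.of_forall fun x => by
      simpa using (norm_lineDeriv_cutoff_le n x i).trans (inv_le_one_of_one_le₀ (by simp))
  choose F' hF' using fun n => exists_isMul hp measurable_const hid (hl n)
    (fun i => EventuallyEq.rfl) (hb1 n) (hb2 n) F
  -- Here the weight does not change, so the cutoffs and their gradients are bounded by 1 uniformly
  -- in n and dominated convergence applies.
  have hlim : Tendsto F' atTop (𝓝 F) := by
    refine IsMul.tendsto (C := 1) hp measurable_const hid (Eventually.of_forall hb1)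
      (Eventually.of_forall hb2) (Eventually.of_forall fun x => by simp)
      (fun i => Eventually.of_forall fun x => by simp) (Eventually.of_forall tendsto_cutoff)
      (fun i => Eventually.of_forall fun x => tendsto_lineDeriv_cutoff x i)
      (Eventually.of_forall hF') (IsMul.one F)
  refine (Submodule.isClosed_topologicalClosure _).mem_of_tendsto hlim
    (Eventually.of_forall fun n => ?_)
  obtain ⟨F₀', hF₀', h₀⟩ := hmul hG₀ hω₀ F₀ hF₀ n
  obtain ⟨F₁', hF₁', h₁⟩ := hmul hG₁ hω₁ F₁ hF₁ n
  -- Each truncation of F is the sum of the truncations of its two summands, now both in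
  -- W_0^{1,p}(U, ω); the closedness of that space then gives F.
  have : F' n = F₀' + F₁' := by
    refine Sobolev.ext_of_ae ?_
    have hadd : Sobolev.comp 0 (F₀' + F₁') =ᵐ[volume.restrict (U : Set (E d))]
        Sobolev.comp 0 F₀' + Sobolev.comp 0 F₁' := by
      rw [map_add]
      exact ω.ac_measure.ae_eq (Lp.coeFn_add _ _)
    have hFadd := AEEqFun.coeFn_add (sobolevIncl p ω₀ F₀) (sobolevIncl p ω₁ F₁)
    rw [← hF] at hFadd
    filter_upwards [hadd, hFadd, (hF' n).1, h₀.1, h₁.1, sobolevIncl_ae F, sobolevIncl_ae F₀,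
      sobolevIncl_ae F₁] with x e1 e2 e3 e4 e5 e6 e7 e8
    rw [e3, e1, Pi.add_apply, e4, e5, ← e6, ← e7, ← e8, e2, Pi.add_apply, mul_add]
  change F' n ∈ sobolevZero p ω
  rw [this]
  exact add_mem hF₀' hF₁'

end Cutoff

/-! ### Interpolation of the full Sobolev spaces and of the closures of Lip_c. -/

/-- Interpolation of `W^{1,p}(U, ω₀)` and `W^{1,p}(U, ω₁)`. -/
theorem eqUpToEquivNorms_sobolev (hp : p ≠ ∞) (hg : LipschitzWith L g)
    (hω : ∀ x ∈ U, ω₀.toFun x = ω₁.toFun x * Real.exp (g x)) (hθ : θ ∈ Icc (0 : ℝ) 1) :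
    ComplexInterp.EqUpToEquivNorms (sobolevIncl p ω₀) (sobolevIncl p ω₁) θ
      (sobolevIncl p (ω₀.interp ω₁ θ)) :=
  eqUpToEquivNorms_of_mulStable hp hg hω hθ LinearIsometry.id LinearIsometry.id LinearIsometry.id
    (fun _ _ _ _ F' _ _ _ _ _ _ => ⟨F', rfl⟩) (fun _ _ _ _ F' _ _ _ _ _ _ => ⟨F', rfl⟩)
    fun F _ _ _ => ⟨F, rfl⟩

/-- Interpolation of `W_0^{1,p}(U, ω₀)` and `W_0^{1,p}(U, ω₁)`. -/
theorem eqUpToEquivNorms_sobolevZero (hp : p ≠ ∞) (hg : LipschitzWith L g)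
    (hω : ∀ x ∈ U, ω₀.toFun x = ω₁.toFun x * Real.exp (g x)) (hθ : θ ∈ Icc (0 : ℝ) 1) :
    ComplexInterp.EqUpToEquivNorms (sobolevZeroIncl p ω₀) (sobolevZeroIncl p ω₁) θ
      (sobolevZeroIncl p (ω₀.interp ω₁ θ)) := by
  have hgm : ∀ κ : ℝ, Measurable fun x => κ * g x := fun κ =>
    hg.continuous.measurable.const_mul κ
  refine eqUpToEquivNorms_of_mulStable hp hg hω hθ (sobolevZero p ω₀).subtypeₗᵢ
    (sobolevZero p ω₁).subtypeₗᵢ (sobolevZero p (ω₀.interp ω₁ θ)).subtypeₗᵢ ?_ ?_ ?_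
  · intro a h k C F' hh hk hC0 hC hCk H
    exact ⟨⟨F', H.mem_sobolevZero hp (hgm _) (Weight.left_eq_interp hω θ) hh hk hC0 hC hCk a.2⟩,
      rfl⟩
  · intro a h k C F' hh hk hC0 hC hCk H
    exact ⟨⟨F', H.mem_sobolevZero hp (hgm _) (Weight.right_eq_interp hω θ) hh hk hC0 hC hCk a.2⟩,
      rfl⟩
  · intro F a₀ a₁ hF
    refine ⟨⟨F, mem_sobolevZero_of_eq_add hp (hg.continuous.const_mul (-θ))
      (hg.continuous.const_mul (1 - θ)) (fun x hx => ?_) (Weight.interp_eq hω θ) a₀.2 a₁.2 hF⟩,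
      rfl⟩
    rw [Weight.interp_eq hω θ x hx, hω x hx, mul_assoc, ← Real.exp_add]
    ring_nf

end WSob

end

theorem theorem1p4 {d : ℕ} (hd : 0 < d) (U : TopologicalSpace.Opens (WSob.E d))
    (hU : (U : Set (WSob.E d)).Nonempty) (ω₀ ω₁ : WSob.Weight U) (g : WSob.E d → ℝ)
    (hg : ∃ L : ℝ≥0, LipschitzOnWith L g U)
    (hω : ∀ x ∈ U, ω₀.toFun x = ω₁.toFun x * Real.exp (g x))
    (hcb : ω₀.CompactlyBounded ∨ ω₁.CompactlyBounded) :
    (ω₀.CompactlyBounded ∧ ω₁.CompactlyBounded ∧ WSob.LocLipschitzOn U (ω₀.ratio ω₁)) ∧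
    (U = ⊤ → ∀ (p : ℝ≥0∞) [Fact (1 ≤ p)], p ≠ ∞ → ∀ θ ∈ Set.Ioo (0 : ℝ) 1,
      ComplexInterp.EqUpToEquivNorms (WSob.sobolevIncl p ω₀) (WSob.sobolevIncl p ω₁) θ
        (WSob.sobolevIncl p (ω₀.interp ω₁ θ))) ∧
    ((∃ (q : ℝ≥0∞) (_ : Fact (1 ≤ q)), q ≠ ∞ ∧ WSob.SimultaneousApprox q ω₀ ω₁) →
      ∀ (p : ℝ≥0∞) [Fact (1 ≤ p)], p ≠ ∞ → ∀ θ ∈ Set.Ioo (0 : ℝ) 1,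
      ComplexInterp.EqUpToEquivNorms (WSob.sobolevZeroIncl p ω₀) (WSob.sobolevZeroIncl p ω₁) θ
        (WSob.sobolevZeroIncl p (ω₀.interp ω₁ θ))) ∧
    (∀ (p : ℝ≥0∞) [Fact (1 ≤ p)], p ≠ ∞ →
      WSob.sobolevZero p ω₀ = ⊤ → WSob.sobolevZero p ω₁ = ⊤ →
      (∀ θ ∈ Set.Ioo (0 : ℝ) 1, WSob.calWZero p ω₀ ω₁ θ = ⊤) →
      ∀ θ ∈ Set.Ioo (0 : ℝ) 1,
      ComplexInterp.EqUpToEquivNorms (WSob.sobolevIncl p ω₀) (WSob.sobolevIncl p ω₁) θ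
        (WSob.sobolevIncl p (ω₀.interp ω₁ θ))) := by
  obtain ⟨L, hL⟩ := hg
  -- g is Lipschitz on U only; a Lipschitz extension to ℝ^d, with the same values on U, makes balls,
  -- line derivatives and Rademacher's theorem available without reference to U.
  obtain ⟨g', hg', hgg'⟩ := hL.extend_real
  have hω' : ∀ x ∈ U, ω₀.toFun x = ω₁.toFun x * Real.exp (g' x) := fun x hx => by
    rw [hω x hx, hgg' hx]
  have hω'' : ∀ x ∈ U, ω₁.toFun x = ω₀.toFun x * Real.exp (-g' x) := fun x hx => by
    rw [hω' x hx, mul_assoc, ← Real.exp_add, add_neg_cancel, Real.exp_zero, mul_one]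
  refine ⟨⟨?_, ?_, WSob.locLipschitzOn_ratio hg' hω'⟩, ?_, ?_, ?_⟩
  · exact hcb.elim id (WSob.Weight.compactlyBounded_of_eq_mul_exp hg'.continuous hω')
  · exact hcb.elim (WSob.Weight.compactlyBounded_of_eq_mul_exp hg'.continuous.neg hω'') id
  · intro _ p _ hp θ hθ
    exact WSob.eqUpToEquivNorms_sobolev hp hg' hω' (Set.Ioo_subset_Icc_self hθ)
  · intro _ p _ hp θ hθ
    exact WSob.eqUpToEquivNorms_sobolevZero hp hg' hω' (Set.Ioo_subset_Icc_self hθ)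
  · intro p _ hp _ _ _ θ hθ
    exact WSob.eqUpToEquivNorms_sobolev hp hg' hω' (Set.Ioo_subset_Icc_self hθ)
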